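/- Let $f\in C^1([0,1])$ be real-valued with $f(0)=f(1)=0$, extended by $0$ to $\mathbb R\setminus[0,1]$. For $c\in\mathbb R$, a front profile with speed $c$ is a function $\varphi\in C^2(\mathbb R)$ with $$\varphi''+c\varphi'+f(\varphi)=0\ \text{ and }\ 0<\varphi<1\ \text{ in }\mathbb R,\qquad \varphi(-\infty)=1,\quad \varphi(+\infty)=0$$ (equivalently, $\varphi(x\cdot e-ct)$ is a traveling front of $\partial_tu=\Delta u+f(u)$ connecting $1$ to $0$). Assume that there is a front profile with some speed $c_0>0$. Then there is $\theta\in(0,1)$ such that $f>0$ in $[\theta,1)$, the set of the speeds of the front profiles has a minimum $c^*$, one has $c^*>0$, and the following properties hold. (i) For every $\theta\in(0,1)$ such that $f>0$ in $[\theta,1)$, there is $\eta\in(0,c^*)$ such that, for every $c\in[c^*-\eta,c^*)$, there are $a>0$ and a (strictly) decreasing function $\underline\varphi\in C^2([0,a])$ with $\underline\varphi''+c\,\underline\varphi'+f(\underline\varphi)=0$ in $[0,a]$ and $$\theta<\underline\varphi(0)<1,\qquad \underline\varphi'(0)=0,\qquad \underline\varphi(a)=0.$$ (ii) For every $c>c^*$,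 there are a (strictly) decreasing function $\overline\varphi\in C^2(\mathbb R)$ with $\overline\varphi''+c\,\overline\varphi'+f(\overline\varphi)=0$ in $\mathbb R$ and real numbers $m>1$ and $b>0$ such that $$\overline\varphi(0)=1,\quad \overline\varphi(+\infty)=0,\quad 0<m^{-1}\overline\varphi\le-\overline\varphi'\le m\,\overline\varphi\ \text{ in }\mathbb R,\quad \overline\varphi''\ge0\ \text{ in }[b,+\infty).$$ (iii) $c^*$ is the Aronson–Weinberger critical speed, defined as follows. For $c\in\mathbb R$ and $\varepsilon>0$, let $p_{c,\varepsilon}$ be the negative solution of $\frac{dp}{dq}=-c-\frac{f(q)}{p}$, $p(0)=-\varepsilon$, in its maximal interval of existence $[0,q_{c,\varepsilon})$, extended by $0$ in $[q_{c,\varepsilon},1]$ if $q_{c,\varepsilon}\le1$. Then the limit $p_c(q)=\lim_{\varepsilon\searrow0}p_{c,\varepsilon}(q)$ exists in $\mathbb R$ for every $c\in\mathbb R$ and $q\in[0,1]$, and $c^*=\inf\{c\in\mathbb R:\ p_c(1)<0\}$, the latter set being non-empty and bounded from below. -/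

import Mathlib

open Set Filter Topology

/-- Reaction terms: `f` is of class `C¹` on `[0,1]`, vanishes at `0` and `1`, and is extended by `0`
outside `[0,1]`. -/
structure IsReaction (f : ℝ → ℝ) : Prop where
  contDiffOn : ContDiffOn ℝ 1 f (Icc 0 1)
  map_zero : f 0 = 0
  map_one : f 1 = 0
  eq_zero_outside : ∀ s, s ∉ Icc (0 : ℝ) 1 → f s = 0

/-- `φ` is the `C²` profile of a traveling front `φ (x · e - c t)` of `∂ₜu = Δu + f(u)` with speed
`c` connecting `1` to `0`. -/
structure IsFrontProfile (f : ℝ → ℝ) (c : ℝ) (φ : ℝ → ℝ) : Prop where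
  contDiff : ContDiff ℝ 2 φ
  eqn : ∀ z, deriv (deriv φ) z + c * deriv φ z + f (φ z) = 0
  mem_Ioo : ∀ z, φ z ∈ Ioo (0 : ℝ) 1
  tendsto_atBot : Tendsto φ atBot (𝓝 1)
  tendsto_atTop : Tendsto φ atTop (𝓝 0)

/-- The set of the speeds `c` (of any sign) of the traveling fronts connecting `1` to `0`. -/
def frontSpeeds (f : ℝ → ℝ) : Set ℝ :=
  {c | ∃ φ, IsFrontProfile f c φ}

/-- `φ` is a decreasing `C²` solution of `φ'' + c φ' + f(φ) = 0` in the compact interval `[0,a]`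
(with one-sided derivatives at the end points), with `θ < φ(0) < 1`, `φ'(0) = 0`, `φ(a) = 0`. -/
structure IsLowerProfile (f : ℝ → ℝ) (θ c a : ℝ) (φ : ℝ → ℝ) : Prop where
  contDiffOn : ContDiffOn ℝ 2 φ (Icc 0 a)
  strictAntiOn : StrictAntiOn φ (Icc 0 a)
  eqn : ∀ z ∈ Icc 0 a,
    derivWithin (derivWithin φ (Icc 0 a)) (Icc 0 a) z + c * derivWithin φ (Icc 0 a) z
      + f (φ z) = 0
  map_zero_mem : φ 0 ∈ Ioo θ 1
  deriv_zero : derivWithin φ (Icc 0 a) 0 = 0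
  map_right : φ a = 0

/-- `φ` is a decreasing `C²` solution of `φ'' + c φ' + f(φ) = 0` in `ℝ` with `φ(0) = 1`,
`φ(+∞) = 0`, `-φ'` comparable to `φ > 0` in `ℝ`, and `φ'' ≥ 0` near `+∞`. -/
structure IsUpperProfile (f : ℝ → ℝ) (c : ℝ) (φ : ℝ → ℝ) : Prop where
  contDiff : ContDiff ℝ 2 φ
  strictAnti : StrictAnti φ
  eqn : ∀ z, deriv (deriv φ) z + c * deriv φ z + f (φ z) = 0
  map_zero : φ 0 = 1
  tendsto_atTop : Tendsto φ atTop (𝓝 0)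
  bounds : ∃ m > 1, ∀ z, 0 < m⁻¹ * φ z ∧ m⁻¹ * φ z ≤ -deriv φ z ∧ -deriv φ z ≤ m * φ z
  convex : ∃ b > 0, ∀ z ∈ Ici b, 0 ≤ deriv (deriv φ) z

/-- `p` is a negative solution of `dp/dq = -c - f(q)/p` in `[0,b)` with `p(0) = -ε`: it
parameterizes a trajectory of `q' = p`, `p' = -c p - f(q)` emerging from the point `(0,-ε)`. -/
structure IsNegativeTrajectory (f : ℝ → ℝ) (c ε b : ℝ) (p : ℝ → ℝ) : Prop where
  map_zero : p 0 = -ε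
  neg : ∀ q ∈ Ico 0 b, p q < 0
  eqn : ∀ q ∈ Ico 0 b, HasDerivWithinAt p (-c - f q / p q) (Ico 0 b) q

open Classical in
/-- The function `p_{c,ε}` on `[0,+∞)`: the value at `q` of the maximal negative trajectory emerging
from `(0,-ε)` if the latter is defined up to and including `q`, and `0` beyond its maximal interval
of existence. (By uniqueness for the Cauchy problem, the value does not depend on the choice of the
negative trajectory which is defined at `q`.) -/
noncomputable def awTrajectory (f : ℝ → ℝ) (c ε q : ℝ) : ℝ :=
  if h : ∃ p : ℝ → ℝ, ∃ b > q, IsNegativeTrajectory f c ε b p then h.choose q else 0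

/-- `p_c`, the limit of `p_{c,ε}` as `ε ↘ 0`. -/
noncomputable def awLimit (f : ℝ → ℝ) (c q : ℝ) : ℝ :=
  limUnder (𝓝[>] (0 : ℝ)) (fun ε => awTrajectory f c ε q)

/-- `s` is the Aronson-Weinberger critical speed: the functions `p_c = lim_{ε ↘ 0} p_{c,ε}` are
well defined in `[0,1]`, and `s` is the (finite) infimum of the `c` such that `p_c(1) < 0`. -/
def IsAronsonWeinbergerSpeed (f : ℝ → ℝ) (s : ℝ) : Prop :=
  (∀ c : ℝ, ∀ q ∈ Icc (0 : ℝ) 1,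
    Tendsto (fun ε => awTrajectory f c ε q) (𝓝[>] (0 : ℝ)) (𝓝 (awLimit f c q))) ∧
  IsGLB {c : ℝ | awLimit f c 1 < 0} s

/-! A decreasing profile `φ` is encoded by its slope as a function of its height, `r(q) =
-φ'(φ⁻¹(q))`, which solves `r' = c - f / r`; conversely `φ` is recovered by inverting a primitive of
`-1 / r`. Two facts make this scalar equation tractable. It obeys a comparison principle whatever
the sign of `f` (`IsPhaseSub.le_of_le`), so explicit barriers control the trajectories. And `(r²)' =
2 (c r - f)` is regular at `r = 0` (`IsPhaseSolution.hasDerivWithinAt_sq`), so limits can be taken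
up to the axis.

A front with `c > 0` amounts to a solution in `(0,1)` bounded linearly at both ends
(`IsPhaseFront`): the linear bounds make the travel time infinite, and without them the profile
would leave `(0,1)` in finite time. The energy `φ'² / 2 + ∫₀^φ f` shows that one front of positive
speed forces `∫₀¹ f > 0`, hence positive speeds for all fronts, and that fronts of positive speed
decrease.

Two families of trajectories are compared: those leaving `(0,0)`, for which `r = -p_c` increases
with `c`, and those leaving `(1,0)`, for which `r` decreases with `c`. Since `f > 0` near `1`, a
front of speed `c₀` forces `p_c(1) < 0` for `c > c₀` (`IsPhaseFront.awLimit_neg`). Conversely, if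
`p_c(1) < 0` with `0 < c ≤ c₀`, the trajectory from `(1,0)` is trapped under those from `(0,-ε)` and
ends at `(0,0)`: it is a front. This survives at the infimum `s` of such `c`
(`IsPhaseFront.exists_critical`), which is thus both the Aronson–Weinberger speed and the least
front speed.

For `c > s` the trajectory from `(0,0)` stays off the axis on `(0,∞)` and gives the upper profile;
convexity near `+∞` comes from `4 f'(0) ≤ s² < c²`. For `0 < c < s` there is no front, so the
trajectory from `(1,0)` reaches `q = 0` with nonzero slope; slightly closer to the axis, another
trajectory starts from a point `(q₁,0)` with `q₁` near `1`, and gives the lower profile. -/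

/-- `r > 0` solves the phase plane equation `r' = c - g / r` in `s`. -/
def IsPhaseSolution (g : ℝ → ℝ) (c : ℝ) (r : ℝ → ℝ) (s : Set ℝ) : Prop :=
  ∀ q ∈ s, 0 < r q ∧ HasDerivWithinAt r (c - g q / r q) s q

/-- `r > 0` is a subsolution of `r' = c - g / r` in `s`. -/
def IsPhaseSub (g : ℝ → ℝ) (c : ℝ) (r : ℝ → ℝ) (s : Set ℝ) : Prop :=
  ∀ q ∈ s, 0 < r q ∧ ∃ d ≤ c - g q / r q, HasDerivWithinAt r d s q

/-- `r > 0` is a supersolution of `r' = c - g / r` in `s`. -/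
def IsPhaseSuper (g : ℝ → ℝ) (c : ℝ) (r : ℝ → ℝ) (s : Set ℝ) : Prop :=
  ∀ q ∈ s, 0 < r q ∧ ∃ d ≥ c - g q / r q, HasDerivWithinAt r d s q

/-! ### Comparison principle for the phase plane equation -/

section Basic

variable {g u v r : ℝ → ℝ} {c c' a b : ℝ} {s t : Set ℝ}

theorem IsPhaseSolution.mono (h : IsPhaseSolution g c r s) (hts : t ⊆ s) :
    IsPhaseSolution g c r t :=
  fun q hq => ⟨(h q (hts hq)).1, (h q (hts hq)).2.mono hts⟩

theorem IsPhaseSolution.sub (h : IsPhaseSolution g c r s) (hc : c ≤ c') : IsPhaseSub g c' r s :=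
  fun q hq => ⟨(h q hq).1, _, by linarith, (h q hq).2⟩

theorem IsPhaseSolution.super (h : IsPhaseSolution g c r s) (hc : c' ≤ c) :
    IsPhaseSuper g c' r s :=
  fun q hq => ⟨(h q hq).1, _, by linarith, (h q hq).2⟩

theorem IsPhaseSub.mono (h : IsPhaseSub g c r s) (hts : t ⊆ s) : IsPhaseSub g c r t := by
  intro q hq
  obtain ⟨h0, d, hd, h1⟩ := h q (hts hq)
  exact ⟨h0, d, hd, h1.mono hts⟩

theorem IsPhaseSolution.continuousOn (h : IsPhaseSolution g c r s) : ContinuousOn r s :=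
  fun q hq => (h q hq).2.continuousWithinAt

theorem IsPhaseSub.continuousOn (h : IsPhaseSub g c r s) : ContinuousOn r s := by
  intro q hq
  obtain ⟨_, _, _, h1⟩ := h q hq
  exact h1.continuousWithinAt

theorem IsPhaseSuper.continuousOn (h : IsPhaseSuper g c r s) : ContinuousOn r s := by
  intro q hq
  obtain ⟨_, _, _, h1⟩ := h q hq
  exact h1.continuousWithinAt

theorem IsPhaseSolution.congr (h : IsPhaseSolution g c u s) (huv : EqOn v u s) :
    IsPhaseSolution g c v s := by
  intro q hq
  rw [huv hq]
  exact ⟨(h q hq).1, (h q hq).2.congr huv (huv hq)⟩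

/-- Reflection of the phase plane equation. -/
theorem IsPhaseSolution.reflect (k : ℝ) (h : IsPhaseSolution g c r s) :
    IsPhaseSolution (fun x => -g (k - x)) (-c) (fun x => r (k - x)) ((fun x => k - x) ⁻¹' s) := by
  intro x hx
  obtain ⟨h0, h1⟩ := h (k - x) hx
  refine ⟨h0, ?_⟩
  have h2 : HasDerivWithinAt (fun x : ℝ => k - x) (-1) ((fun x => k - x) ⁻¹' s) x := by
    simpa using ((hasDerivAt_id x).const_sub k).hasDerivWithinAt
  have h3 := HasDerivWithinAt.comp x h1 h2 (fun y hy => hy)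
  refine h3.congr_deriv ?_
  ring

theorem monotoneOn_Icc_of_hasDerivAt {F : ℝ → ℝ} (hF : ContinuousOn F (Icc a b))
    (hd : ∀ x ∈ Ioo a b, ∃ d ≥ 0, HasDerivAt F d x) : MonotoneOn F (Icc a b) := by
  apply monotoneOn_of_deriv_nonneg (convex_Icc a b) hF
  · rw [interior_Icc]
    intro x hx
    obtain ⟨d, _, h⟩ := hd x hx
    exact h.differentiableAt.differentiableWithinAt
  · rw [interior_Icc]
    intro x hx
    obtain ⟨d, h0, h⟩ := hd x hx
    rw [h.deriv]
    exact h0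

/-- Subtracting the two inequalities gives `(v - u)' ≥ g / (u v) * (v - u)`, a linear inequality, so
the integrating factor `exp (-∫ g / (u v))` makes the difference monotone. No sign of `g` is needed.
-/
theorem IsPhaseSub.exists_monotoneOn (hab : a ≤ b) (hg : ContinuousOn g (Icc a b))
    (hu : IsPhaseSub g c u (Icc a b)) (hv : IsPhaseSuper g c v (Icc a b)) :
    ∃ m : ℝ → ℝ, (∀ q, 0 < m q) ∧ MonotoneOn (fun q => m q * (v q - u q)) (Icc a b) := by
  have hcont : ContinuousOn (fun q => g q / (u q * v q)) (Icc a b) := by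
    refine hg.div (hu.continuousOn.mul hv.continuousOn) fun q hq => ?_
    exact (mul_pos (hu q hq).1 (hv q hq).1).ne'
  set h : ℝ → ℝ := IccExtend hab ((Icc a b).domRestrict fun q => g q / (u q * v q)) with hh
  have hc : Continuous h := (continuousOn_iff_continuous_domRestrict.1 hcont).Icc_extend'
  have hval : ∀ q ∈ Icc a b, h q = g q / (u q * v q) := fun q hq => by
    rw [hh, IccExtend_of_mem _ _ hq]; rfl
  have hH : ∀ q, HasDerivAt (fun q => ∫ x in a..q, h x) (h q) q := fun q =>
    (hc.integral_hasStrictDerivAt a q).hasDerivAt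
  refine ⟨fun q => Real.exp (-∫ x in a..q, h x), fun q => Real.exp_pos _, ?_⟩
  apply monotoneOn_Icc_of_hasDerivAt
  · refine ContinuousOn.mul ?_ (hv.continuousOn.sub hu.continuousOn)
    exact (Real.continuous_exp.comp
      (continuous_iff_continuousAt.2 fun q => (hH q).continuousAt).neg).continuousOn
  · intro q hq
    have hq' := Ioo_subset_Icc_self hq
    obtain ⟨u0, du, hdu, hu1⟩ := hu q hq'
    obtain ⟨v0, dv, hdv, hv1⟩ := hv q hq'
    have hu2 := hu1.hasDerivAt (Icc_mem_nhds hq.1 hq.2)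
    have hv2 := hv1.hasDerivAt (Icc_mem_nhds hq.1 hq.2)
    refine ⟨_, ?_, ((hH q).neg.exp.mul (hv2.sub hu2))⟩
    have h1 : h q * (v q - u q) ≤ dv - du := by
      rw [hval q hq']
      have : g q / (u q * v q) * (v q - u q) = g q / u q - g q / v q := by
        field_simp
      linarith
    have h2 := Real.exp_pos (-∫ x in a..q, h x)
    have h3 := mul_nonneg h2.le (sub_nonneg.2 h1)
    simp only [Pi.neg_apply]
    nlinarith [h3]

theorem IsPhaseSub.le_of_le (hab : a ≤ b) (hg : ContinuousOn g (Icc a b))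
    (hu : IsPhaseSub g c u (Icc a b)) (hv : IsPhaseSuper g c v (Icc a b)) (h : u a ≤ v a) :
    u b ≤ v b := by
  obtain ⟨m, hm, hmono⟩ := hu.exists_monotoneOn hab hg hv
  have h1 := hmono (left_mem_Icc.2 hab) (right_mem_Icc.2 hab) hab
  have h2 : 0 ≤ m a * (v a - u a) := mul_nonneg (hm a).le (sub_nonneg.2 h)
  have h3 : 0 ≤ m b * (v b - u b) := h2.trans h1
  have := nonneg_of_mul_nonneg_right h3 (hm b)
  linarith

theorem IsPhaseSub.lt_of_lt (hab : a ≤ b) (hg : ContinuousOn g (Icc a b))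
    (hu : IsPhaseSub g c u (Icc a b)) (hv : IsPhaseSuper g c v (Icc a b)) (h : u a < v a) :
    u b < v b := by
  obtain ⟨m, hm, hmono⟩ := hu.exists_monotoneOn hab hg hv
  have h1 := hmono (left_mem_Icc.2 hab) (right_mem_Icc.2 hab) hab
  have h2 : 0 < m a * (v a - u a) := mul_pos (hm a) (sub_pos.2 h)
  have h3 : 0 < m b * (v b - u b) := h2.trans_le h1
  have := pos_of_mul_pos_right h3 (hm b).le
  linarith

/-- If `Y' ≤ 2 (c √Y - g)` then `√Y` is a subsolution. -/
theorem isPhaseSub_sqrt {Y Y' : ℝ → ℝ} (hpos : ∀ q ∈ s, 0 < Y q)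
    (hY : ∀ q ∈ s, HasDerivWithinAt Y (Y' q) s q)
    (hle : ∀ q ∈ s, Y' q ≤ 2 * (c * √(Y q) - g q)) : IsPhaseSub g c (fun q => √(Y q)) s := by
  intro q hq
  have h0 := Real.sqrt_pos.2 (hpos q hq)
  refine ⟨h0, _, ?_, (hY q hq).sqrt (hpos q hq).ne'⟩
  rw [div_le_iff₀ (by positivity)]
  have : (c - g q / √(Y q)) * (2 * √(Y q)) = 2 * (c * √(Y q) - g q) := by
    field_simp
  linarith [hle q hq]

end Basic

/-! ### Existence, continuation and uniqueness away from the axis -/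

section Existence

variable {g : ℝ → ℝ} {c a b δ ρ : ℝ}

/-- Replacing `R` by `max R δ` in the denominator makes the right-hand side bounded and Lipschitz in
`R`, so Picard–Lindelöf applies on the whole interval at once. -/
theorem exists_truncated (hg : Continuous g) (hab : a ≤ b) (hδ : 0 < δ) (c ρ : ℝ) :
    ∃ R : ℝ → ℝ, R a = ρ ∧
      ∀ q ∈ Icc a b, HasDerivWithinAt R (c - g q / max (R q) δ) (Icc a b) q := by
  obtain ⟨G, hG⟩ := isCompact_Icc.exists_bound_of_continuousOn (hg.continuousOn (s := Icc a b))
  have hG0 : 0 ≤ G := (norm_nonneg _).trans (hG a (left_mem_Icc.2 hab))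
  have hL : 0 ≤ |c| + G / δ := by positivity
  have hK : 0 ≤ G / δ ^ 2 := by positivity
  have hA : 0 ≤ (|c| + G / δ) * (b - a) := mul_nonneg hL (sub_nonneg.2 hab)
  have hpl : IsPicardLindelof (fun q x => c - g q / max x δ) (tmin := a) (tmax := b)
      ⟨a, left_mem_Icc.2 hab⟩ ρ ⟨_, hA⟩ 0 ⟨_, hL⟩ ⟨_, hK⟩ := by
    refine ⟨?_, ?_, ?_, ?_⟩
    · intro t ht
      refine LipschitzOnWith.of_dist_le_mul fun x _ y _ => ?_
      have hx : 0 < max x δ := lt_max_of_lt_right hδ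
      have hy : 0 < max y δ := lt_max_of_lt_right hδ
      rw [Real.dist_eq, Real.dist_eq]
      have e : c - g t / max x δ - (c - g t / max y δ) =
          g t * (max x δ - max y δ) / (max x δ * max y δ) := by
        field_simp; ring
      rw [e, abs_div, abs_mul]
      have h1 : |max x δ - max y δ| ≤ |x - y| := abs_max_sub_max_le_abs x y δ
      have h2 : δ ^ 2 ≤ |max x δ * max y δ| := by
        rw [abs_of_pos (mul_pos hx hy), sq]
        exact mul_le_mul (le_max_right _ _) (le_max_right _ _) hδ.le hx.le
      have h3 : |g t| ≤ G := hG t ht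
      show _ ≤ G / δ ^ 2 * |x - y|
      rw [div_mul_eq_mul_div]
      apply div_le_div₀ (by positivity) _ (by positivity) h2
      exact mul_le_mul h3 h1 (abs_nonneg _) hG0
    · intro x _
      exact (continuous_const.sub (hg.div_const _)).continuousOn
    · intro t ht x _
      show |c - g t / max x δ| ≤ |c| + G / δ
      refine (abs_sub _ _).trans ?_
      gcongr
      rw [abs_div, abs_of_pos (lt_max_of_lt_right hδ : (0:ℝ) < max x δ)]
      apply div_le_div₀ hG0 (hG t ht) hδ (le_max_right _ _)
    · show (|c| + G / δ) * max (b - a) (a - a) ≤ (|c| + G / δ) * (b - a) - 0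
      rw [sub_self, max_eq_left (sub_nonneg.2 hab), sub_zero]
  obtain ⟨R, hR0, hR⟩ := hpl.exists_eq_forall_mem_Icc_hasDerivWithinAt₀
  exact ⟨R, hR0, hR⟩

/-- Continuity induction: as long as `B ≤ R` one has `R > δ`, the truncation is inactive slightly
further to the right, and comparison carries `B ≤ R` there. -/
theorem IsPhaseSub.le_truncated {B R : ℝ → ℝ} (hg : Continuous g)
    (hδ : 0 < δ) (hR : ∀ q ∈ Icc a b, HasDerivWithinAt R (c - g q / max (R q) δ) (Icc a b) q)
    (hB : IsPhaseSub g c B (Icc a b)) (hBδ : ∀ q ∈ Icc a b, δ < B q) (h0 : B a ≤ R a) :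
    ∀ q ∈ Icc a b, B q ≤ R q := by
  have hRc : ContinuousOn R (Icc a b) := fun q hq => (hR q hq).continuousWithinAt
  have key : Icc a b ⊆ {q | B q ≤ R q} := by
    apply IsClosed.Icc_subset_of_forall_exists_gt
    · have := isClosed_Icc.isClosed_le (hB.continuousOn) hRc
      convert this using 1
      ext x; simp [and_comm]
    · exact h0
    · rintro x ⟨hx, hxab⟩ y hy
      have hxI : x ∈ Icc a b := Ico_subset_Icc_self hxab
      have hRx : δ < R x := (hBδ x hxI).trans_le hx
      have hev : ∀ᶠ z in 𝓝[≥] x, δ < R z := by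
        have h1 : Tendsto R (𝓝[≥] x) (𝓝 (R x)) := by
          have := (hRc x hxI).mono (Icc_subset_Icc_left hxab.1 : Icc x b ⊆ Icc a b)
          rwa [ContinuousWithinAt, nhdsWithin_Icc_eq_nhdsGE hxab.2] at this
        exact h1.eventually (lt_mem_nhds hRx)
      obtain ⟨w, hw, hwsub⟩ := (mem_nhdsGE_iff_exists_Ico_subset.1 hev)
      have hxw : x < w := hw
      set z := min (min y b) ((x + w) / 2) with hz
      have hxz : x < z := by
        simp only [hz, lt_min_iff]; exact ⟨⟨hy, hxab.2⟩, by linarith⟩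
      have hzb : z ≤ b := (min_le_left _ _).trans (min_le_right _ _)
      have hzw : z < w := (min_le_right _ _).trans_lt (by linarith)
      have hsub : Icc x z ⊆ Icc a b := Icc_subset_Icc hxab.1 hzb
      refine ⟨z, ?_, hxz, (min_le_left _ _).trans (min_le_left _ _)⟩
      refine (hB.mono hsub).le_of_le hxz.le hg.continuousOn (v := R) ?_ hx
      intro q hq
      have h2 : δ < R q := hwsub ⟨hq.1, hq.2.trans_lt hzw⟩
      refine ⟨hδ.trans h2, _, ?_, (hR q (hsub hq)).mono hsub⟩
      rw [max_eq_left h2.le]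
  exact key

theorem isPhaseSolution_of_truncated {R : ℝ → ℝ} (hδ : 0 < δ)
    (hR : ∀ q ∈ Icc a b, HasDerivWithinAt R (c - g q / max (R q) δ) (Icc a b) q)
    (h : ∀ q ∈ Icc a b, δ ≤ R q) : IsPhaseSolution g c R (Icc a b) := by
  intro q hq
  refine ⟨hδ.trans_le (h q hq), ?_⟩
  have := hR q hq
  rwa [max_eq_left (h q hq)] at this

theorem exists_pos_lt_of_continuousOn {B : ℝ → ℝ} (hab : a ≤ b) (hB : ContinuousOn B (Icc a b))
    (hpos : ∀ q ∈ Icc a b, 0 < B q) : ∃ δ > 0, ∀ q ∈ Icc a b, δ < B q := by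
  obtain ⟨x, hx, hmin⟩ := isCompact_Icc.exists_isMinOn (nonempty_Icc.2 hab) hB
  exact ⟨B x / 2, half_pos (hpos x hx), fun q hq => (half_lt_self (hpos x hx)).trans_le (hmin hq)⟩

/-- Above a subsolution, solutions of the phase plane equation do not break down. -/
theorem IsPhaseSub.exists_solution {B : ℝ → ℝ} (hg : Continuous g) (hab : a ≤ b)
    (hB : IsPhaseSub g c B (Icc a b)) (h0 : B a ≤ ρ) :
    ∃ r, IsPhaseSolution g c r (Icc a b) ∧ r a = ρ := by
  obtain ⟨δ, hδ, hBδ⟩ := exists_pos_lt_of_continuousOn hab hB.continuousOn fun q hq => (hB q hq).1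
  obtain ⟨R, hR0, hR⟩ := exists_truncated hg hab hδ c ρ
  have := hB.le_truncated hg hδ hR hBδ (by rwa [hR0])
  exact ⟨R, isPhaseSolution_of_truncated hδ hR fun q hq => (hBδ q hq).le.trans (this q hq), hR0⟩

/-- `awTrajectory` at `q` requires a trajectory defined strictly beyond `q`; this turns a solution
on a closed interval into one. -/
theorem IsPhaseSolution.exists_extension {r : ℝ → ℝ} (hg : Continuous g) (hab : a ≤ b)
    (hr : IsPhaseSolution g c r (Icc a b)) :
    ∃ b' > b, ∃ r', IsPhaseSolution g c r' (Icc a b') ∧ r' a = r a := by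
  obtain ⟨δ, hδ, hBδ⟩ := exists_pos_lt_of_continuousOn hab hr.continuousOn fun q hq => (hr q hq).1
  obtain ⟨R, hR0, hR⟩ := exists_truncated hg (by linarith : a ≤ b + 1) hδ c (r a)
  have hsub : Icc a b ⊆ Icc a (b + 1) := Icc_subset_Icc_right (by linarith)
  have hle := (hr.sub le_rfl).le_truncated hg hδ
    (fun q hq => (hR q (hsub hq)).mono hsub) hBδ hR0.ge
  have hRb : δ < R b := (hBδ b (right_mem_Icc.2 hab)).trans_le (hle b (right_mem_Icc.2 hab))
  have hev : ∀ᶠ z in 𝓝[≥] b, δ < R z := by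
    have h1 : Tendsto R (𝓝[≥] b) (𝓝 (R b)) := by
      have := (hR b ⟨hab, by linarith⟩).continuousWithinAt.mono
        (Icc_subset_Icc_left hab : Icc b (b + 1) ⊆ Icc a (b + 1))
      rwa [ContinuousWithinAt, nhdsWithin_Icc_eq_nhdsGE (by linarith)] at this
    exact h1.eventually (lt_mem_nhds hRb)
  obtain ⟨w, hw, hwsub⟩ := (mem_nhdsGE_iff_exists_Ico_subset.1 hev)
  have hbw : b < w := hw
  set z := min (b + 1) ((b + w) / 2) with hz
  have hbz : b < z := by simp only [hz, lt_min_iff]; constructor <;> linarith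
  have hzw : z < w := (min_le_right _ _).trans_lt (by linarith)
  have hsub' : Icc a z ⊆ Icc a (b + 1) := Icc_subset_Icc_right (min_le_left _ _)
  refine ⟨z, hbz, R, ?_, hR0⟩
  refine isPhaseSolution_of_truncated hδ (fun q hq => (hR q (hsub' hq)).mono hsub') fun q hq => ?_
  rcases le_total q b with h | h
  · exact (hBδ q ⟨hq.1, h⟩).le.trans (hle q ⟨hq.1, h⟩)
  · exact (hwsub ⟨h, hq.2.trans_lt hzw⟩ : δ < R q).le

theorem IsPhaseSolution.eqOn {r r' : ℝ → ℝ} (hg : Continuous g)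
    (hr : IsPhaseSolution g c r (Icc a b)) (hr' : IsPhaseSolution g c r' (Icc a b))
    (h : r a = r' a) : EqOn r r' (Icc a b) := by
  intro q hq
  have hs : Icc a q ⊆ Icc a b := Icc_subset_Icc_right hq.2
  exact le_antisymm
    (((hr.mono hs).sub le_rfl).le_of_le hq.1 hg.continuousOn ((hr'.mono hs).super le_rfl) h.le)
    (((hr'.mono hs).sub le_rfl).le_of_le hq.1 hg.continuousOn ((hr.mono hs).super le_rfl) h.ge)

end Existence

/-! ### The Aronson–Weinberger trajectories and their limit -/

section AW

variable {g : ℝ → ℝ} {c c' ε ε' b q : ℝ}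

theorem IsNegativeTrajectory.isPhaseSolution {p : ℝ → ℝ} (h : IsNegativeTrajectory g c ε b p) :
    IsPhaseSolution g c (fun x => -p x) (Ico 0 b) := by
  intro q hq
  refine ⟨neg_pos.2 (h.neg q hq), (h.eqn q hq).neg.congr_deriv ?_⟩
  rw [div_neg]; ring

theorem IsPhaseSolution.isNegativeTrajectory {r : ℝ → ℝ} (h : IsPhaseSolution g c r (Ico 0 b))
    (h0 : r 0 = ε) : IsNegativeTrajectory g c ε b (fun x => -r x) := by
  refine ⟨by simp [h0], fun q hq => neg_lt_zero.2 (h q hq).1, fun q hq => ?_⟩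
  refine (h q hq).2.neg.congr_deriv ?_
  rw [div_neg]; ring

/-- By uniqueness, the trajectory picked by `choose` can be replaced by any solution at hand. -/
theorem IsPhaseSolution.awTrajectory_eq {r : ℝ → ℝ} (hg : Continuous g)
    (hr : IsPhaseSolution g c r (Icc 0 b)) (h0 : r 0 = ε) (hq : q ∈ Icc 0 b) :
    awTrajectory g c ε q = -r q := by
  obtain ⟨b', hb', r', hr', h0'⟩ := hr.exists_extension hg (hq.1.trans hq.2)
  have h : ∃ p : ℝ → ℝ, ∃ b > q, IsNegativeTrajectory g c ε b p :=
    ⟨_, b', hq.2.trans_lt hb', (hr'.mono Ico_subset_Icc_self).isNegativeTrajectory (h0'.trans h0)⟩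
  rw [awTrajectory, dif_pos h]
  obtain ⟨d, hd, hp⟩ := h.choose_spec
  have h1 := hp.isPhaseSolution.mono (Icc_subset_Ico_right hd : Icc 0 q ⊆ Ico 0 d)
  have h2 := h1.eqOn hg (hr.mono (Icc_subset_Icc_right hq.2))
    (by rw [h0, hp.map_zero, neg_neg]) (right_mem_Icc.2 hq.1)
  linarith

theorem exists_of_awTrajectory_neg (h : awTrajectory g c ε q < 0) :
    ∃ b > q, ∃ r, IsPhaseSolution g c r (Icc 0 b) ∧ r 0 = ε := by
  rw [awTrajectory] at h
  split_ifs at h with h'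
  · obtain ⟨d, hd, hp⟩ := h'.choose_spec
    have hd' : q < d := hd
    refine ⟨(q + d) / 2, by show q < _; linarith, _, hp.isPhaseSolution.mono
      (Icc_subset_Ico_right (by linarith)), by rw [hp.map_zero, neg_neg]⟩
  · exact absurd h (lt_irrefl 0)

theorem awTrajectory_nonpos (hq : 0 ≤ q) : awTrajectory g c ε q ≤ 0 := by
  rw [awTrajectory]
  split_ifs with h
  · obtain ⟨d, hd, hp⟩ := h.choose_spec
    exact (hp.neg q ⟨hq, hd⟩).le
  · exact le_rfl

theorem isPhaseSolution_awTrajectory (hg : Continuous g) (h : awTrajectory g c ε q < 0) :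
    IsPhaseSolution g c (fun x => -awTrajectory g c ε x) (Icc 0 q) := by
  obtain ⟨b, hb, r, hr, h0⟩ := exists_of_awTrajectory_neg h
  have hs : Icc 0 q ⊆ Icc 0 b := Icc_subset_Icc_right (le_of_lt hb)
  refine (hr.mono hs).congr fun x hx => ?_
  rw [hr.awTrajectory_eq hg h0 (hs hx), neg_neg]

theorem awTrajectory_zero (hg : Continuous g) (hε : 0 < ε) : awTrajectory g c ε 0 = -ε := by
  have : IsPhaseSolution g c (fun _ => ε) (Icc 0 0) := by
    intro q hq
    refine ⟨hε, ?_⟩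
    rw [Icc_self] at hq ⊢
    rw [mem_singleton_iff.1 hq]
    exact hasDerivWithinAt_iff_hasFDerivWithinAt.2 (.of_subsingleton subsingleton_singleton)
  exact this.awTrajectory_eq hg rfl (left_mem_Icc.2 le_rfl)

/-- A trajectory is a subsolution for every larger speed, hence it prevents those with larger `c`
and `ε` from breaking down before it does. If it has already broken down, its value is `0` and there
is nothing to compare. -/
theorem awTrajectory_anti (hg : Continuous g) (hc : c ≤ c') (hε : ε ≤ ε')
    (hq : 0 ≤ q) : awTrajectory g c' ε' q ≤ awTrajectory g c ε q := by
  rcases (awTrajectory_nonpos hq : awTrajectory g c ε q ≤ 0).lt_or_eq with h | h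
  · obtain ⟨b, hb, r, hr, h0⟩ := exists_of_awTrajectory_neg h
    have hr1 := hr.mono (Icc_subset_Icc_right (le_of_lt hb) : Icc 0 q ⊆ Icc 0 b)
    obtain ⟨r', hr', h0'⟩ := (hr1.sub hc).exists_solution hg hq (h0.trans_le hε)
    have hm := right_mem_Icc.2 hq
    rw [hr'.awTrajectory_eq hg h0' hm, hr1.awTrajectory_eq hg h0 hm]
    exact neg_le_neg ((hr1.sub hc).le_of_le hq hg.continuousOn (hr'.super le_rfl)
      (by rw [h0, h0']; exact hε))
  · rw [h]; exact awTrajectory_nonpos hq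

theorem tendsto_awTrajectory (hg : Continuous g) (hq : 0 ≤ q) :
    Tendsto (fun ε => awTrajectory g c ε q) (𝓝[>] (0 : ℝ)) (𝓝 (awLimit g c q)) := by
  have h1 : AntitoneOn (fun ε => awTrajectory g c ε q) (Ioi 0) :=
    fun x _ y _ hxy => awTrajectory_anti hg le_rfl hxy hq
  have h2 : BddAbove ((fun ε => awTrajectory g c ε q) '' Ioi 0) := by
    refine ⟨0, ?_⟩
    rintro _ ⟨x, _, rfl⟩
    exact awTrajectory_nonpos hq
  exact tendsto_nhds_limUnder ⟨_, h1.tendsto_nhdsGT h2⟩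

theorem awLimit_nonpos (hg : Continuous g) (hq : 0 ≤ q) : awLimit g c q ≤ 0 :=
  le_of_tendsto (tendsto_awTrajectory hg hq) (Eventually.of_forall fun _ => awTrajectory_nonpos hq)

theorem awTrajectory_le_awLimit (hg : Continuous g) (hε : 0 < ε) (hq : 0 ≤ q) :
    awTrajectory g c ε q ≤ awLimit g c q := by
  refine ge_of_tendsto (tendsto_awTrajectory hg hq) ?_
  filter_upwards [Ioo_mem_nhdsGT hε] with x hx
  exact awTrajectory_anti hg le_rfl hx.2.le hq

theorem awLimit_le {k : ℝ} (hg : Continuous g) (hq : 0 ≤ q)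
    (h : ∀ ε > 0, awTrajectory g c ε q ≤ k) : awLimit g c q ≤ k := by
  refine le_of_tendsto (tendsto_awTrajectory hg hq) ?_
  filter_upwards [self_mem_nhdsWithin] with x hx using h x hx

theorem awLimit_anti (hg : Continuous g) (hc : c ≤ c') (hq : 0 ≤ q) :
    awLimit g c' q ≤ awLimit g c q :=
  le_of_tendsto_of_tendsto (tendsto_awTrajectory hg hq) (tendsto_awTrajectory hg hq)
    (Eventually.of_forall fun _ => awTrajectory_anti hg hc le_rfl hq)

theorem awLimit_zero (hg : Continuous g) : awLimit g c 0 = 0 := by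
  refine tendsto_nhds_unique (tendsto_awTrajectory hg le_rfl) ?_
  have h : Tendsto (fun ε : ℝ => -ε) (𝓝[>] (0 : ℝ)) (𝓝 0) := by
    have : Tendsto (fun ε : ℝ => -ε) (𝓝 (0 : ℝ)) (𝓝 (-0)) := continuous_neg.tendsto 0
    rw [neg_zero] at this
    exact this.mono_left nhdsWithin_le_nhds
  refine h.congr' ?_
  filter_upwards [self_mem_nhdsWithin] with x hx
  exact (awTrajectory_zero hg hx).symm

/-- For `r²` the singularity of the equation at `r = 0` disappears; this is what allows limits of
trajectories that touch the axis. -/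
theorem IsPhaseSolution.hasDerivWithinAt_sq {r : ℝ → ℝ} {s : Set ℝ}
    (h : IsPhaseSolution g c r s) (hq : q ∈ s) :
    HasDerivWithinAt (fun x => r x ^ 2) (2 * (c * r q - g q)) s q := by
  obtain ⟨h0, h1⟩ := h q hq
  refine (h1.pow 2).congr_deriv ?_
  field_simp
  ring

/-- The equation for the squares, in integrated form, passes to the limit `ε → 0` by dominated
convergence. -/
theorem hasDerivWithinAt_awLimit_sq (hg : Continuous g) (hb : 0 ≤ b)
    (h : ∀ ε > 0, awTrajectory g c ε b < 0) (hq : q ∈ Icc 0 b) :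
    HasDerivWithinAt (fun x => awLimit g c x ^ 2) (2 * (c * -awLimit g c q - g q)) (Icc 0 b) q := by
  set r : ℝ → ℝ → ℝ := fun ε x => -awTrajectory g c ε x with hr
  set L : ℝ → ℝ := fun x => -awLimit g c x with hL
  have hsol : ∀ ε > 0, IsPhaseSolution g c (r ε) (Icc 0 b) :=
    fun ε hε => isPhaseSolution_awTrajectory hg (h ε hε)
  have hlim : ∀ x ∈ Icc 0 b, Tendsto (fun ε => r ε x) (𝓝[>] 0) (𝓝 (L x)) :=
    fun x hx => (tendsto_awTrajectory hg hx.1).neg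
  obtain ⟨C, hC⟩ := isCompact_Icc.exists_bound_of_continuousOn (hsol 1 one_pos).continuousOn
  obtain ⟨G, hG⟩ := isCompact_Icc.exists_bound_of_continuousOn (hg.continuousOn (s := Icc 0 b))
  -- By monotonicity in `ε`, the trajectory with `ε = 1` dominates all those with `ε < 1`.
  have hbd : ∀ ε ∈ Ioo (0 : ℝ) 1, ∀ x ∈ Icc 0 b, ‖2 * (c * r ε x - g x)‖ ≤ 2 * (|c| * C + G) := by
    intro ε hε x hx
    rw [norm_mul, Real.norm_two]
    have h1 : |r ε x| ≤ C := by
      refine le_trans ?_ (hC x hx)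
      rw [abs_of_pos (hsol ε hε.1 x hx).1]
      refine le_trans ?_ (le_abs_self _)
      exact neg_le_neg (awTrajectory_anti hg le_rfl hε.2.le hx.1)
    have h2 : |g x| ≤ G := hG x hx
    have h3 : ‖c * r ε x - g x‖ ≤ |c| * C + G := by
      refine (norm_sub_le _ _).trans ?_
      rw [norm_mul]
      exact add_le_add (mul_le_mul_of_nonneg_left h1 (abs_nonneg c)) h2
    linarith
  have hev : ∀ᶠ ε in 𝓝[>] (0 : ℝ), ε ∈ Ioo (0 : ℝ) 1 := Ioo_mem_nhdsGT one_pos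
  -- The uniform Lipschitz bound on the squares gives the continuity of `L`, needed to differentiate
  -- the limit integral.
  have hLip : ∀ x ∈ Icc 0 b, ∀ y ∈ Icc 0 b,
      ‖L y ^ 2 - L x ^ 2‖ ≤ 2 * (|c| * C + G) * ‖y - x‖ := by
    intro x hx y hy
    refine le_of_tendsto ((((hlim y hy).pow 2).sub ((hlim x hx).pow 2)).norm) ?_
    filter_upwards [hev] with ε hε
    exact (convex_Icc 0 b).norm_image_sub_le_of_norm_hasDerivWithin_le
      (fun z hz => (hsol ε hε.1).hasDerivWithinAt_sq hz) (hbd ε hε) hx hy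
  have hLsq : ContinuousOn (fun x => L x ^ 2) (Icc 0 b) := by
    have : LipschitzOnWith (Real.toNNReal (2 * (|c| * C + G))) (fun x => L x ^ 2) (Icc 0 b) := by
      refine LipschitzOnWith.of_dist_le_mul fun x hx y hy => ?_
      rw [dist_eq_norm, dist_eq_norm]
      refine (hLip y hy x hx).trans ?_
      gcongr
      exact Real.le_coe_toNNReal _
    exact this.continuousOn
  have hLc : ContinuousOn L (Icc 0 b) := by
    refine hLsq.sqrt.congr fun x hx => ?_
    exact (Real.sqrt_sq (neg_nonneg.2 (awLimit_nonpos hg hx.1))).symm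
  have hhc : ContinuousOn (fun x => 2 * (c * L x - g x)) (Icc 0 b) :=
    continuousOn_const.mul ((continuousOn_const.mul hLc).sub hg.continuousOn)
  set k : ℝ → ℝ := IccExtend hb ((Icc 0 b).domRestrict fun x => 2 * (c * L x - g x)) with hk
  have hkc : Continuous k := (continuousOn_iff_continuous_domRestrict.1 hhc).Icc_extend'
  have hkval : ∀ x ∈ Icc 0 b, k x = 2 * (c * L x - g x) := fun x hx => by
    rw [hk, IccExtend_of_mem _ _ hx]; rfl
  have hint : ∀ x ∈ Icc 0 b, L x ^ 2 = ∫ t in (0 : ℝ)..x, k t := by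
    intro x hx
    have hsub : uIcc 0 x ⊆ Icc 0 b := by
      rw [uIcc_of_le hx.1]; exact Icc_subset_Icc_right hx.2
    have hsub' : uIoc 0 x ⊆ Icc 0 b := uIoc_subset_uIcc.trans hsub
    have hrc : ∀ ε > 0, ContinuousOn (fun t => 2 * (c * r ε t - g t)) (Icc 0 b) := fun ε hε =>
      continuousOn_const.mul ((continuousOn_const.mul (hsol ε hε).continuousOn).sub hg.continuousOn)
    have h1 : Tendsto (fun ε => ∫ t in (0 : ℝ)..x, 2 * (c * r ε t - g t)) (𝓝[>] 0)
        (𝓝 (∫ t in (0 : ℝ)..x, k t)) := by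
      refine intervalIntegral.tendsto_integral_filter_of_dominated_convergence
        (fun _ => 2 * (|c| * C + G)) ?_ ?_ intervalIntegrable_const ?_
      · filter_upwards [hev] with ε hε
        exact ((hrc ε hε.1).mono hsub').aestronglyMeasurable measurableSet_uIoc
      · filter_upwards [hev] with ε hε
        exact Eventually.of_forall fun t ht => hbd ε hε t (hsub' ht)
      · refine Eventually.of_forall fun t ht => ?_
        rw [hkval t (hsub' ht)]
        exact (((hlim t (hsub' ht)).const_mul c).sub_const _).const_mul 2
    have h2 : Tendsto (fun ε => r ε x ^ 2 - r ε 0 ^ 2) (𝓝[>] 0) (𝓝 (L x ^ 2 - L 0 ^ 2)) :=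
      ((hlim x hx).pow 2).sub ((hlim 0 (left_mem_Icc.2 hb)).pow 2)
    have h3 : L 0 = 0 := by simp only [hL, awLimit_zero hg, neg_zero]
    rw [h3] at h2
    have h4 := tendsto_nhds_unique h1 (h2.congr' ?_)
    · rw [h4]; ring
    filter_upwards [hev] with ε hε
    symm
    refine intervalIntegral.integral_eq_sub_of_hasDerivAt_of_le (f := fun t => r ε t ^ 2) hx.1
      (((hsol ε hε.1).continuousOn.pow 2).mono (Icc_subset_Icc_right hx.2)) ?_ ?_
    · intro t ht
      exact ((hsol ε hε.1).hasDerivWithinAt_sq ⟨ht.1.le, ht.2.le.trans hx.2⟩).hasDerivAt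
        (Icc_mem_nhds ht.1 (ht.2.trans_le hx.2))
    · exact ((hrc ε hε.1).mono hsub).intervalIntegrable
  have hfin : HasDerivWithinAt (fun x => L x ^ 2) (k q) (Icc 0 b) q :=
    ((hkc.integral_hasStrictDerivAt 0 q).hasDerivAt.hasDerivWithinAt).congr hint (hint q hq)
  rw [hkval q hq] at hfin
  refine hfin.congr (fun x _ => ?_) ?_ <;> simp [hL]

theorem isPhaseSolution_awLimit {s : Set ℝ} (hg : Continuous g) (hb : 0 ≤ b)
    (h : ∀ ε > 0, awTrajectory g c ε b < 0) (hs : s ⊆ Icc 0 b) (hneg : ∀ x ∈ s, awLimit g c x < 0) :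
    IsPhaseSolution g c (fun x => -awLimit g c x) s := by
  intro q hq
  have h0 := hneg q hq
  refine ⟨neg_pos.2 h0, ?_⟩
  have h1 := ((hasDerivWithinAt_awLimit_sq hg hb h (hs hq)).mono hs).sqrt
    (pow_ne_zero 2 h0.ne)
  have he : √(awLimit g c q ^ 2) = -awLimit g c q := by
    rw [← neg_sq, Real.sqrt_sq (neg_pos.2 h0).le]
  rw [he] at h1
  refine (h1.congr (fun x hx => ?_) ?_).congr_deriv ?_
  · rw [← neg_sq, Real.sqrt_sq (neg_pos.2 (hneg x hx)).le]
  · exact he.symm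
  · have h2 : -awLimit g c q ≠ 0 := (neg_pos.2 h0).ne'
    rw [div_eq_iff (mul_ne_zero two_ne_zero h2), sub_mul,
      show g q / -awLimit g c q * (2 * -awLimit g c q) =
        2 * (g q / -awLimit g c q * -awLimit g c q) by ring, div_mul_cancel₀ _ h2]
    ring

/-- Linear upper bound for the trajectories emerging from `(0, ε)`. -/
theorem neg_awTrajectory_le {M K : ℝ} (hg : Continuous g) (hM : ∀ x ∈ Icc 0 q, -(M * x) ≤ g x)
    (hM0 : 0 ≤ M) (hK : 0 < K) (hcK : c + M / K ≤ K) (hε : 0 < ε) (hq : 0 ≤ q) :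
    -awTrajectory g c ε q ≤ ε + K * q := by
  rcases (awTrajectory_nonpos hq : awTrajectory g c ε q ≤ 0).lt_or_eq with h | h
  · have h1 := isPhaseSolution_awTrajectory hg h
    -- With `g ≥ -M x` one has `g / (ε + K x) ≥ -M / K`, so the slope `K ≥ c + M / K` is large
    -- enough.
    have h2 : IsPhaseSuper g c (fun x => ε + K * x) (Icc 0 q) := by
      intro x hx
      have hpos : 0 < ε + K * x := by have := mul_nonneg hK.le hx.1; linarith
      refine ⟨hpos, K, ?_, ?_⟩
      · have : -(M / K) ≤ g x / (ε + K * x) := by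
          rw [le_div_iff₀ hpos]
          have e : -(M / K) * (ε + K * x) = -(M * x) - M / K * ε := by field_simp; ring
          have : 0 ≤ M / K * ε := by positivity
          linarith [hM x hx]
        show _ ≤ _
        linarith
      · simpa using (((hasDerivAt_id x).const_mul K).const_add ε).hasDerivWithinAt
    refine (h1.sub le_rfl).le_of_le hq hg.continuousOn h2 ?_
    simp [awTrajectory_zero hg hε]
  · rw [h]; have := mul_nonneg hK.le hq; linarith

theorem neg_awLimit_le {M K : ℝ} (hg : Continuous g) (hM : ∀ x ∈ Icc 0 q, -(M * x) ≤ g x)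
    (hM0 : 0 ≤ M) (hK : 0 < K) (hcK : c + M / K ≤ K) (hq : 0 ≤ q) :
    -awLimit g c q ≤ K * q := by
  refine le_of_forall_pos_le_add fun ε hε => ?_
  have h1 := neg_awTrajectory_le hg hM hM0 hK hcK hε hq
  have h2 := awTrajectory_le_awLimit (c := c) hg hε hq
  linarith

end AW

/-! ### Lipschitz bounds and `C²` criteria -/

section Regularity

variable {f : ℝ → ℝ}

theorem IsReaction.eq_comp_projIcc (hf : IsReaction f) (x : ℝ) :
    f x = f (projIcc (0 : ℝ) 1 zero_le_one x) := by
  rcases lt_or_ge x 0 with h | h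
  · rw [projIcc_of_le_left _ h.le, hf.map_zero, hf.eq_zero_outside x fun h' => h.not_ge h'.1]
  · rcases le_or_gt x 1 with h1 | h1
    · rw [projIcc_of_mem _ ⟨h, h1⟩]
    · rw [projIcc_of_right_le _ h1.le, hf.map_one, hf.eq_zero_outside x fun h' => h1.not_ge h'.2]

theorem IsReaction.exists_lipschitz (hf : IsReaction f) :
    ∃ M ≥ 0, ∀ x y, |f x - f y| ≤ M * |x - y| := by
  obtain ⟨K, hK⟩ := hf.contDiffOn.exists_lipschitzOnWith one_ne_zero (convex_Icc 0 1) isCompact_Icc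
  refine ⟨K, K.2, fun x y => ?_⟩
  rw [hf.eq_comp_projIcc x, hf.eq_comp_projIcc y]
  have h1 := hK.dist_le_mul _ (projIcc (0 : ℝ) 1 zero_le_one x).2 _
    (projIcc (0 : ℝ) 1 zero_le_one y).2
  rw [Real.dist_eq] at h1
  refine h1.trans (mul_le_mul_of_nonneg_left ?_ K.2)
  have h2 := (LipschitzWith.projIcc (zero_le_one (α := ℝ))).dist_le_mul x y
  rw [NNReal.coe_one, one_mul] at h2
  exact h2

theorem continuous_of_lipschitz {M : ℝ} (h : ∀ x y, |f x - f y| ≤ M * |x - y|) : Continuous f := by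
  have : LipschitzWith (Real.toNNReal M) f := LipschitzWith.of_dist_le_mul fun x y => by
    rw [Real.dist_eq, Real.dist_eq]
    exact (h x y).trans (mul_le_mul_of_nonneg_right (Real.le_coe_toNNReal M) (abs_nonneg _))
  exact this.continuous

theorem IsReaction.continuous (hf : IsReaction f) : Continuous f := by
  obtain ⟨M, _, h⟩ := hf.exists_lipschitz
  exact continuous_of_lipschitz h

/-- Such a `K` makes the lines of slope `±K` near the equilibria barriers for the phase plane
equation, `M` being a Lipschitz constant of `f`. -/
theorem exists_slope (c : ℝ) {M : ℝ} (hM : 0 ≤ M) : ∃ K > 0, |c| + M / K ≤ K := by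
  refine ⟨|c| + M + 1, by positivity, ?_⟩
  have : M / (|c| + M + 1) ≤ 1 := (div_le_one (by positivity)).2 (by linarith [abs_nonneg c])
  linarith

theorem contDiff_two_of_hasDerivAt {φ g h : ℝ → ℝ} (h1 : ∀ z, HasDerivAt φ (g z) z)
    (h2 : ∀ z, HasDerivAt g (h z) z) (h3 : Continuous h) : ContDiff ℝ 2 φ := by
  have e1 : deriv φ = g := funext fun z => (h1 z).deriv
  have e2 : deriv g = h := funext fun z => (h2 z).deriv
  rw [show (2 : WithTop ℕ∞) = 1 + 1 from one_add_one_eq_two.symm, contDiff_succ_iff_deriv, e1,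
    contDiff_one_iff_deriv, e2]
  exact ⟨fun z => (h1 z).differentiableAt, by simp, fun z => (h2 z).differentiableAt, h3⟩

theorem contDiffOn_two_of_hasDerivWithinAt {φ g h : ℝ → ℝ} {s : Set ℝ} (hs : UniqueDiffOn ℝ s)
    (h1 : ∀ z ∈ s, HasDerivWithinAt φ (g z) s z) (h2 : ∀ z ∈ s, HasDerivWithinAt g (h z) s z)
    (h3 : ContinuousOn h s) : ContDiffOn ℝ 2 φ s := by
  have e1 : ∀ z ∈ s, derivWithin φ s z = g z := fun z hz => (h1 z hz).derivWithin (hs z hz)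
  have e2 : ∀ z ∈ s, derivWithin g s z = h z := fun z hz => (h2 z hz).derivWithin (hs z hz)
  rw [show (2 : WithTop ℕ∞) = 1 + 1 from one_add_one_eq_two.symm,
    contDiffOn_succ_iff_derivWithin hs]
  refine ⟨fun z hz => (h1 z hz).differentiableWithinAt, by simp, ContDiffOn.congr ?_ e1⟩
  rw [← zero_add (1 : WithTop ℕ∞), contDiffOn_succ_iff_derivWithin hs]
  exact ⟨fun z hz => (h2 z hz).differentiableWithinAt, by simp,
    contDiffOn_zero.2 (h3.congr e2)⟩

end Regularity

/-! ### From phase plane solutions to profiles -/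

section Inverse

variable {D : Set ℝ} {h h' : ℝ → ℝ}

theorem strictAntiOn_of_hasDerivAt_neg (hD : D.OrdConnected) (hd : ∀ q ∈ D, HasDerivAt h (h' q) q)
    (hneg : ∀ q ∈ D, h' q < 0) : StrictAntiOn h D := by
  refine strictAntiOn_of_deriv_neg hD.convex (fun q hq => (hd q hq).continuousAt.continuousWithinAt)
    fun q hq => ?_
  rw [(hd q (interior_subset hq)).deriv]
  exact hneg q (interior_subset hq)

/-- One-dimensional inverse function theorem for decreasing functions. -/
theorem exists_hasDerivAt_inverse (hDo : IsOpen D) (hD : D.OrdConnected)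
    (hd : ∀ q ∈ D, HasDerivAt h (h' q) q) (hneg : ∀ q ∈ D, h' q < 0) :
    ∃ ψ : ℝ → ℝ, (∀ q ∈ D, ψ (h q) = q) ∧ ∀ q ∈ D, HasDerivAt ψ (h' q)⁻¹ (h q) := by
  have hanti := strictAntiOn_of_hasDerivAt_neg hD hd hneg
  have hcont : ContinuousOn h D := fun q hq => (hd q hq).continuousAt.continuousWithinAt
  have hinv : ∀ q ∈ D, Function.invFunOn h D (h q) = q := fun q hq =>
    hanti.injOn.leftInvOn_invFunOn hq
  refine ⟨Function.invFunOn h D, hinv, fun q hq => ?_⟩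
  have hnear : ∀ ε > 0, ∃ a ∈ D, ∃ b ∈ D, a < q ∧ q < b ∧ q - ε ≤ a ∧ b ≤ q + ε := by
    intro ε hε
    obtain ⟨l, u, hlu, hsub⟩ := mem_nhds_iff_exists_Ioo_subset.1 (hDo.mem_nhds hq)
    refine ⟨max (q - ε) ((l + q) / 2), hsub ⟨?_, ?_⟩, min (q + ε) ((u + q) / 2), hsub ⟨?_, ?_⟩,
      ?_, ?_, le_max_left _ _, min_le_left _ _⟩ <;> simp <;> grind
  have hnhds : ∀ a ∈ D, ∀ b ∈ D, a < q → q < b → ∀ᶠ y in 𝓝 (h q),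
      ∃ x ∈ Icc a b, h x = y := by
    intro a ha b hb haq hqb
    filter_upwards [Ioo_mem_nhds (hanti hq hb hqb) (hanti ha hq haq)] with y hy
    exact intermediate_value_Icc' (haq.trans hqb).le (hcont.mono (hD.out ha hb))
      ⟨hy.1.le, hy.2.le⟩
  have hca : ContinuousAt (Function.invFunOn h D) (h q) := by
    rw [Metric.continuousAt_iff']
    intro ε hε
    obtain ⟨a, ha, b, hb, haq, hqb, h1, h2⟩ := hnear (ε / 2) (half_pos hε)
    filter_upwards [hnhds a ha b hb haq hqb] with y ⟨x, hx, hxy⟩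
    rw [← hxy, hinv x (hD.out ha hb hx), hinv q hq, Real.dist_eq, abs_lt]
    constructor <;> linarith [hx.1, hx.2]
  refine HasDerivAt.of_local_left_inverse hca (f := h) ?_ (hneg q hq).ne ?_
  · rw [hinv q hq]; exact hd q hq
  · obtain ⟨a, ha, b, hb, haq, hqb, -, -⟩ := hnear 1 one_pos
    filter_upwards [hnhds a ha b hb haq hqb] with y ⟨x, hx, hxy⟩
    rw [← hxy, hinv x (hD.out ha hb hx)]

theorem exists_antideriv {k : ℝ → ℝ} (hDo : IsOpen D) (hD : D.OrdConnected) {q₀ : ℝ} (h0 : q₀ ∈ D)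
    (hk : ContinuousOn k D) : ∃ Z : ℝ → ℝ, Z q₀ = 0 ∧ ∀ q ∈ D, HasDerivAt Z (k q) q := by
  refine ⟨fun q => ∫ x in q₀..q, k x, by simp, fun q hq => ?_⟩
  exact intervalIntegral.integral_hasDerivAt_right
    (hk.mono (hD.uIcc_subset h0 hq)).intervalIntegrable
    (hk.stronglyMeasurableAtFilter hDo q hq) (hk.continuousAt (hDo.mem_nhds hq))

/-- Reconstruction of a monotone profile from a solution of the phase plane equation. -/
theorem IsPhaseSolution.exists_profile {f r : ℝ → ℝ} {c q₀ : ℝ} (hf : Continuous f)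
    (hDo : IsOpen D) (hD : D.OrdConnected) (h0 : q₀ ∈ D) (hr : IsPhaseSolution f c r D)
    -- `Z` is the time at which the profile has height `q`; its being unbounded in both directions
    -- means that the profile is defined on all of `ℝ`.
    (hZ : ∀ Z : ℝ → ℝ, (∀ q ∈ D, HasDerivAt Z (-(r q)⁻¹) q) → ∀ t,
      (∃ q ∈ D, t ≤ Z q) ∧ ∃ q ∈ D, Z q ≤ t) :
    ∃ φ : ℝ → ℝ, ContDiff ℝ 2 φ ∧ StrictAnti φ ∧ (∀ z, φ z ∈ D) ∧ φ 0 = q₀ ∧ range φ = D ∧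
      (∀ z, deriv φ z = -r (φ z)) ∧
      ∀ z, deriv (deriv φ) z = c * r (φ z) - f (φ z) := by
  have hrc := hr.continuousOn
  have hpos : ∀ q ∈ D, 0 < r q := fun q hq => (hr q hq).1
  obtain ⟨Z, hZ0, hZd⟩ := exists_antideriv hDo hD h0
    (hrc.inv₀ fun q hq => (hpos q hq).ne').neg
  have hZd' : ∀ q ∈ D, HasDerivAt Z (-(r q)⁻¹) q := hZd
  have hZneg : ∀ q ∈ D, -(r q)⁻¹ < 0 := fun q hq => neg_lt_zero.2 (inv_pos.2 (hpos q hq))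
  have hanti := strictAntiOn_of_hasDerivAt_neg hD hZd' hZneg
  obtain ⟨φ, hφ, hφd⟩ := exists_hasDerivAt_inverse hDo hD hZd' hZneg
  have hsurj : ∀ t, ∃ q ∈ D, Z q = t := by
    intro t
    obtain ⟨⟨a, ha, hat⟩, b, hb, hbt⟩ := hZ Z hZd' t
    exact hD.isPreconnected.intermediate_value hb ha
      (fun q hq => (hZd' q hq).continuousAt.continuousWithinAt) ⟨hbt, hat⟩
  have hmem : ∀ z, φ z ∈ D := fun z => by
    obtain ⟨q, hq, rfl⟩ := hsurj z
    rwa [hφ q hq]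
  have h1 : ∀ z, HasDerivAt φ (-r (φ z)) z := fun z => by
    obtain ⟨q, hq, rfl⟩ := hsurj z
    rw [hφ q hq]
    refine (hφd q hq).congr_deriv ?_
    rw [inv_neg, inv_inv]
  have h2 : ∀ z, HasDerivAt (fun z => -r (φ z)) (c * r (φ z) - f (φ z)) z := fun z => by
    have h3 := (hr _ (hmem z)).2.hasDerivAt (hDo.mem_nhds (hmem z))
    refine (h3.comp z (h1 z)).neg.congr_deriv ?_
    have := (hpos _ (hmem z)).ne'
    field_simp
  have hφc : Continuous φ := continuous_iff_continuousAt.2 fun z => (h1 z).continuousAt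
  have h3 : Continuous fun z => c * r (φ z) - f (φ z) :=
    (continuous_const.mul (hrc.comp_continuous hφc hmem)).sub (hf.comp hφc)
  refine ⟨φ, contDiff_two_of_hasDerivAt h1 h2 h3, ?_, hmem, by rw [← hZ0, hφ _ h0], ?_,
    fun z => (h1 z).deriv, fun z => ?_⟩
  · intro x y hxy
    obtain ⟨q, hq, rfl⟩ := hsurj x
    obtain ⟨p, hp, rfl⟩ := hsurj y
    rw [hφ q hq, hφ p hp]
    exact (hanti.lt_iff_gt hq hp).1 hxy
  · ext q
    refine ⟨?_, fun hq => ⟨Z q, hφ q hq⟩⟩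
    rintro ⟨z, rfl⟩
    exact hmem z
  · rw [show deriv φ = fun z => -r (φ z) from funext fun z => (h1 z).deriv]
    exact (h2 z).deriv

/-- Integration of `1 / r ≥ 1 / (K q)`. The logarithm diverges at `0` and at `+∞`, so a linear bound
on `r` makes the travel time infinite at both. -/
theorem log_div_le_of_hasDerivAt {Z r : ℝ → ℝ} {K a b : ℝ} (ha : 0 < a) (hab : a ≤ b)
    (hZ : ∀ q ∈ Icc a b, HasDerivAt Z (-(r q)⁻¹) q)
    (hr : ∀ q ∈ Icc a b, 0 < r q ∧ r q ≤ K * q) :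
    K⁻¹ * (Real.log b - Real.log a) ≤ Z a - Z b := by
  have h1 : ∀ q ∈ Icc a b, HasDerivAt (fun q => -(Z q) - K⁻¹ * Real.log q)
      (-(-(r q)⁻¹) - K⁻¹ * q⁻¹) q := fun q hq =>
    (hZ q hq).neg.sub ((Real.hasDerivAt_log (ha.trans_le hq.1).ne').const_mul _)
  have h2 : MonotoneOn (fun q => -(Z q) - K⁻¹ * Real.log q) (Icc a b) := by
    apply monotoneOn_Icc_of_hasDerivAt fun q hq => (h1 q hq).continuousAt.continuousWithinAt
    intro q hq
    have hq' := Ioo_subset_Icc_self hq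
    refine ⟨_, ?_, h1 q hq'⟩
    rw [neg_neg, ← mul_inv, ge_iff_le, sub_nonneg]
    exact inv_anti₀ (hr q hq').1 (hr q hq').2
  have := h2 (left_mem_Icc.2 hab) (right_mem_Icc.2 hab) hab
  simp only at this
  linarith

theorem exists_le_antideriv_near_zero {Z r : ℝ → ℝ} {K b : ℝ} (hK : 0 < K) (hb : 0 < b)
    (hZ : ∀ q ∈ Ioc 0 b, HasDerivAt Z (-(r q)⁻¹) q)
    (hr : ∀ q ∈ Ioc 0 b, 0 < r q ∧ r q ≤ K * q) (t : ℝ) : ∃ q ∈ Ioc 0 b, t ≤ Z q := by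
  set s := |t - Z b| with hs
  have hs0 : 0 ≤ s := abs_nonneg _
  have ha : 0 < b * Real.exp (-(K * s)) := mul_pos hb (Real.exp_pos _)
  have hab : b * Real.exp (-(K * s)) ≤ b := by
    apply mul_le_of_le_one_right hb.le
    rw [Real.exp_le_one_iff]
    have := mul_nonneg hK.le hs0
    linarith
  -- The point `b e^(-K s)` is where the logarithmic estimate yields a time gain of exactly `s`.
  refine ⟨_, ⟨ha, hab⟩, ?_⟩
  have hsub : Icc (b * Real.exp (-(K * s))) b ⊆ Ioc 0 b := fun q hq => ⟨ha.trans_le hq.1, hq.2⟩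
  have h1 := log_div_le_of_hasDerivAt ha hab (fun q hq => hZ q (hsub hq))
    fun q hq => hr q (hsub hq)
  rw [Real.log_mul hb.ne' (Real.exp_pos _).ne', Real.log_exp] at h1
  have h2 : K⁻¹ * (Real.log b - (Real.log b + -(K * s))) = s := by field_simp; ring
  linarith [le_abs_self (t - Z b)]

theorem exists_antideriv_le_near_top {Z r : ℝ → ℝ} {K a : ℝ} (hK : 0 < K) (ha : 0 < a)
    (hZ : ∀ q ∈ Ici a, HasDerivAt Z (-(r q)⁻¹) q)
    (hr : ∀ q ∈ Ici a, 0 < r q ∧ r q ≤ K * q) (t : ℝ) : ∃ q ∈ Ici a, Z q ≤ t := by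
  set s := |Z a - t| with hs
  have hs0 : 0 ≤ s := abs_nonneg _
  have hab : a ≤ a * Real.exp (K * s) := by
    apply le_mul_of_one_le_right ha.le
    rw [Real.one_le_exp_iff]
    exact mul_nonneg hK.le hs0
  refine ⟨_, hab, ?_⟩
  have h1 := log_div_le_of_hasDerivAt ha hab (fun q hq => hZ q hq.1) fun q hq => hr q hq.1
  rw [Real.log_mul ha.ne' (Real.exp_pos _).ne', Real.log_exp] at h1
  have h2 : K⁻¹ * (Real.log a + K * s - Real.log a) = s := by field_simp; ring
  linarith [le_abs_self (Z a - t)]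

end Inverse

/-! ### Phase plane fronts -/

/-- `r` is the phase plane trajectory of a front with speed `c`: a solution of the phase plane
equation in `(0,1)` which vanishes at least linearly at `0` and `1`. -/
structure IsPhaseFront (f : ℝ → ℝ) (c : ℝ) (r : ℝ → ℝ) : Prop where
  sol : IsPhaseSolution f c r (Ioo 0 1)
  eq_zero : ∀ q, q ∉ Ioo (0 : ℝ) 1 → r q = 0
  bound : ∃ K > 0, ∀ q, 0 ≤ r q ∧ r q ≤ K * |q| ∧ r q ≤ K * |1 - q|

section PhaseFront

variable {f r : ℝ → ℝ} {c K : ℝ}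

theorem IsPhaseSolution.isPhaseFront (hr : IsPhaseSolution f c r (Ioo 0 1)) (hK : 0 < K)
    (h0 : ∀ q ∈ Ioo (0 : ℝ) 1, r q ≤ K * q) (h1 : ∀ q ∈ Ioo (0 : ℝ) 1, r q ≤ K * (1 - q)) :
    IsPhaseFront f c (indicator (Ioo 0 1) r) := by
  refine ⟨hr.congr fun q hq => indicator_of_mem hq r, fun q hq => indicator_of_notMem hq r,
    K, hK, fun q => ?_⟩
  by_cases hq : q ∈ Ioo (0 : ℝ) 1
  · rw [indicator_of_mem hq, abs_of_pos hq.1, abs_of_pos (sub_pos.2 hq.2)]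
    exact ⟨(hr q hq).1.le, h0 q hq, h1 q hq⟩
  · rw [indicator_of_notMem hq]
    exact ⟨le_rfl, by positivity, by positivity⟩

theorem hasDerivAt_zero_of_le_sq {F : ℝ → ℝ} {q C : ℝ} (h : ∀ x, |F x| ≤ C * |x - q| ^ 2) :
    HasDerivAt F 0 q := by
  have h1 : F =O[𝓝 q] fun x => ‖x - q‖ ^ 2 := by
    refine Asymptotics.IsBigO.of_bound C (Eventually.of_forall fun x => ?_)
    rw [norm_pow, norm_norm]
    exact h x
  simpa using (h1.hasFDerivAt one_lt_two).hasDerivAt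

/-- At `0` and `1` the linear bounds make `r²` quadratically small, so the equation for `r²` holds
on all of `ℝ`, equilibria included. -/
theorem IsPhaseFront.hasDerivAt_sq (hf : IsReaction f) (hr : IsPhaseFront f c r) (q : ℝ) :
    HasDerivAt (fun x => r x ^ 2) (2 * (c * r q - f q)) q := by
  obtain ⟨K, hK, hb⟩ := hr.bound
  by_cases hq : q ∈ Ioo (0 : ℝ) 1
  · exact (hr.sol.hasDerivWithinAt_sq hq).hasDerivAt (isOpen_Ioo.mem_nhds hq)
  have hfq : f q = 0 := by
    by_cases hq' : q ∈ Icc (0 : ℝ) 1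
    · rcases eq_endpoints_or_mem_Ioo_of_mem_Icc hq' with rfl | rfl | h
      · exact hf.map_zero
      · exact hf.map_one
      · exact absurd h hq
    · exact hf.eq_zero_outside q hq'
  rw [hr.eq_zero q hq, hfq, mul_zero, sub_zero, mul_zero]
  have hle : ∀ (x y : ℝ), r x ≤ K * |y| → |r x ^ 2| ≤ K ^ 2 * |y| ^ 2 := fun x y h => by
    rw [abs_of_nonneg (sq_nonneg _), ← mul_pow]
    exact pow_le_pow_left₀ (hb x).1 h 2
  rcases le_or_gt q 0 with h | h
  · refine hasDerivAt_zero_of_le_sq (C := K ^ 2) fun x => hle x (x - q) ?_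
    by_cases hx : x ∈ Ioo (0 : ℝ) 1
    · refine (hb x).2.1.trans (mul_le_mul_of_nonneg_left ?_ hK.le)
      rw [abs_of_pos hx.1]
      exact le_trans (by linarith) (le_abs_self _)
    · rw [hr.eq_zero x hx]; positivity
  · have h1 : 1 ≤ q := not_lt.1 fun h1 => hq ⟨h, h1⟩
    refine hasDerivAt_zero_of_le_sq (C := K ^ 2) fun x => hle x (x - q) ?_
    by_cases hx : x ∈ Ioo (0 : ℝ) 1
    · refine (hb x).2.2.trans (mul_le_mul_of_nonneg_left ?_ hK.le)
      rw [abs_of_pos (sub_pos.2 hx.2), abs_sub_comm]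
      exact le_trans (by linarith) (le_abs_self _)
    · rw [hr.eq_zero x hx]; positivity

theorem IsPhaseFront.exists_isFrontProfile (hf : Continuous f) (hr : IsPhaseFront f c r) :
    ∃ φ, IsFrontProfile f c φ := by
  obtain ⟨K, hK, hb⟩ := hr.bound
  have hmem : (1 / 2 : ℝ) ∈ Ioo (0 : ℝ) 1 := by constructor <;> norm_num
  obtain ⟨φ, h1, h2, h3, -, h5, h6, h7⟩ := hr.sol.exists_profile hf isOpen_Ioo ordConnected_Ioo
    hmem (by
      intro Z hZ t
      constructor
      · obtain ⟨q, hq, ht⟩ := exists_le_antideriv_near_zero hK (by norm_num : (0 : ℝ) < 1 / 2)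
          (Z := Z) (r := r) (fun q hq => hZ q ⟨hq.1, hq.2.trans_lt (by norm_num)⟩)
          (fun q hq => ⟨(hr.sol q ⟨hq.1, hq.2.trans_lt (by norm_num)⟩).1, by
            have := (hb q).2.1
            rwa [abs_of_pos hq.1] at this⟩) t
        exact ⟨q, ⟨hq.1, hq.2.trans_lt (by norm_num)⟩, ht⟩
      -- The end `q = 1` is brought to `0` by the reflection `x = 1 - q`, which also changes the
      -- sign of the time.
      · have hm : ∀ x ∈ Ioc (0 : ℝ) (1 / 2), 1 - x ∈ Ioo (0 : ℝ) 1 := fun x hx =>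
          ⟨by linarith [hx.2], by linarith [hx.1]⟩
        obtain ⟨q, hq, ht⟩ := exists_le_antideriv_near_zero hK (by norm_num : (0 : ℝ) < 1 / 2)
          (Z := fun x => -Z (1 - x)) (r := fun x => r (1 - x)) (fun q hq => by
            have e := (hZ _ (hm q hq)).comp q ((hasDerivAt_id q).const_sub 1)
            refine e.neg.congr_deriv ?_
            simp) (fun q hq => ⟨(hr.sol _ (hm q hq)).1, by
            have := (hb (1 - q)).2.2
            rwa [sub_sub_cancel, abs_of_pos hq.1] at this⟩) (-t)
        exact ⟨1 - q, hm q hq, by linarith⟩)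
  refine ⟨φ, h1, fun z => ?_, h3, ?_, ?_⟩
  · rw [h6, h7]; ring
  · refine tendsto_atBot_isLUB h2.antitone ?_
    rw [h5]
    exact isLUB_Ioo zero_lt_one
  · refine tendsto_atTop_isGLB h2.antitone ?_
    rw [h5]
    exact isGLB_Ioo zero_lt_one

/-- The line is a supersolution: a solution under it at `q` would still be under it at `b`. Hence a
solution which exceeds `K q` by some `κ` keeps this excess on the way to `q = 0`. -/
theorem IsPhaseSolution.linear_le_left {M q b κ : ℝ} (hf : Continuous f) (hM : ∀ x, |f x| ≤ M * |x|)
    (hM0 : 0 ≤ M) (hK : 0 < K) (hcK : |c| + M / K ≤ K) (hq : 0 ≤ q) (hqb : q ≤ b) (hκ : 0 < κ)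
    (hr : IsPhaseSolution f c r (Icc q b)) (h : K * b + κ ≤ r b) : K * q + κ ≤ r q := by
  have h2 : IsPhaseSuper f c (fun x => K * x + κ) (Icc q b) := by
    intro x hx
    have hx0 : 0 ≤ x := hq.trans hx.1
    have hpos : 0 < K * x + κ := by positivity
    refine ⟨hpos, K, ?_, ?_⟩
    · have : -(M / K) ≤ f x / (K * x + κ) := by
        rw [le_div_iff₀ hpos]
        have e : -(M / K) * (K * x + κ) = -(M * x) - M / K * κ := by field_simp; ring
        have h3 : 0 ≤ M / K * κ := by positivity
        have h4 := hM x
        rw [abs_of_nonneg hx0] at h4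
        linarith [neg_abs_le (f x)]
      show _ ≤ _
      linarith [le_abs_self c]
    · simpa using (((hasDerivAt_id x).const_mul K).add_const κ).hasDerivWithinAt
  by_contra! h'
  exact ((hr.sub le_rfl).lt_of_lt hqb hf.continuousOn h2 h').not_ge h

/-- Counterpart at `q = 1`, where the descending line is a subsolution. -/
theorem IsPhaseSolution.linear_le_right {M q b κ : ℝ} (hf : Continuous f)
    (hM : ∀ x, |f x| ≤ M * |1 - x|)
    (hM0 : 0 ≤ M) (hK : 0 < K) (hcK : |c| + M / K ≤ K) (hq : b ≤ 1) (hqb : q ≤ b) (hκ : 0 < κ)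
    (hr : IsPhaseSolution f c r (Icc q b)) (h : K * (1 - q) + κ ≤ r q) :
    K * (1 - b) + κ ≤ r b := by
  have h2 : IsPhaseSub f c (fun x => K * (1 - x) + κ) (Icc q b) := by
    intro x hx
    have hx0 : 0 ≤ 1 - x := by linarith [hx.2]
    have hpos : 0 < K * (1 - x) + κ := by positivity
    refine ⟨hpos, -K, ?_, ?_⟩
    · have : f x / (K * (1 - x) + κ) ≤ M / K := by
        rw [div_le_iff₀ hpos]
        have e : M / K * (K * (1 - x) + κ) = M * (1 - x) + M / K * κ := by field_simp
        have h3 : 0 ≤ M / K * κ := by positivity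
        have h4 := hM x
        rw [abs_of_nonneg hx0] at h4
        linarith [le_abs_self (f x)]
      linarith [neg_abs_le c]
    · simpa using ((((hasDerivAt_id x).const_sub 1).const_mul K).add_const κ).hasDerivWithinAt
  exact h2.le_of_le hqb hf.continuousOn (hr.super le_rfl) h

end PhaseFront

/-! ### Fronts: energy, monotonicity, passage to the phase plane -/

section Front

variable {f φ r : ℝ → ℝ} {c : ℝ}

theorem IsFrontProfile.hasDerivAt (h : IsFrontProfile f c φ) (z : ℝ) :
    HasDerivAt φ (deriv φ z) z :=
  (h.contDiff.differentiable two_ne_zero z).hasDerivAt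

theorem IsFrontProfile.hasDerivAt_deriv (h : IsFrontProfile f c φ) (z : ℝ) :
    HasDerivAt (deriv φ) (-(c * deriv φ z) - f (φ z)) z := by
  have h1 : ContDiff ℝ 1 (deriv φ) := by
    have := h.contDiff
    rw [show (2 : WithTop ℕ∞) = 1 + 1 from one_add_one_eq_two.symm, contDiff_succ_iff_deriv] at this
    exact this.2.2
  refine (h1.differentiable one_ne_zero z).hasDerivAt.congr_deriv ?_
  linarith [h.eqn z]

theorem IsFrontProfile.hasDerivAt_energy (hf : Continuous f) (h : IsFrontProfile f c φ) (z : ℝ) :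
    HasDerivAt (fun z => deriv φ z ^ 2 / 2 + ∫ x in (0 : ℝ)..φ z, f x) (-(c * deriv φ z ^ 2)) z := by
  have h1 := ((h.hasDerivAt_deriv z).pow 2).div_const 2
  have h2 := (hf.integral_hasStrictDerivAt 0 (φ z)).hasDerivAt.comp z (h.hasDerivAt z)
  refine (h1.add h2).congr_deriv ?_
  simp
  ring

/-- Mean value theorem on an interval of length `1`. Smallness of `φ'` at some arbitrarily large
points is all that the energy argument requires. -/
theorem IsFrontProfile.exists_deriv_small (h : IsFrontProfile f c φ) {η : ℝ} (hη : 0 < η) (N : ℝ) :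
    ∃ z ≥ N, |deriv φ z| < η := by
  have h1 := (h.tendsto_atTop.eventually (gt_mem_nhds hη)).and (eventually_ge_atTop N)
  obtain ⟨a, ha⟩ := eventually_atTop.1 h1
  obtain ⟨x, hx, hd⟩ := exists_deriv_eq_slope φ (lt_add_one a)
    (fun z _ => (h.hasDerivAt z).continuousAt.continuousWithinAt)
    fun z _ => (h.hasDerivAt z).differentiableAt.differentiableWithinAt
  refine ⟨x, (ha x hx.1.le).2, ?_⟩
  rw [hd, add_sub_cancel_left, div_one, abs_lt]
  have e1 := (ha a le_rfl).1
  have e2 := (ha (a + 1) (by linarith)).1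
  constructor <;> linarith [(h.mem_Ioo a).1, (h.mem_Ioo (a + 1)).1]

/-- If `c ≤ 0` the energy is nondecreasing, and it is close to `0` at suitable points near `+∞`, so
it is nonpositive everywhere; at `-∞` this forces `∫₀¹ f ≤ 0`. -/
theorem IsFrontProfile.speed_pos (hf : Continuous f) (hF : 0 < ∫ x in (0 : ℝ)..1, f x)
    (h : IsFrontProfile f c φ) : 0 < c := by
  by_contra! hc
  set F : ℝ → ℝ := fun q => ∫ x in (0 : ℝ)..q, f x with hFdef
  have hFc : Continuous F :=
    continuous_iff_continuousAt.2 fun q => (hf.integral_hasStrictDerivAt 0 q).hasDerivAt.continuousAt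
  set E : ℝ → ℝ := fun z => deriv φ z ^ 2 / 2 + F (φ z) with hE
  have hmono : Monotone E := by
    refine monotone_of_deriv_nonneg (fun z => (h.hasDerivAt_energy hf z).differentiableAt) fun z => ?_
    rw [(h.hasDerivAt_energy hf z).deriv]
    nlinarith [sq_nonneg (deriv φ z)]
  have hF0 : F 0 = 0 := by simp [hFdef]
  have h0 : Tendsto (fun z => F (φ z)) atTop (𝓝 0) := by
    rw [← hF0]; exact (hFc.tendsto 0).comp h.tendsto_atTop
  have h1 : Tendsto (fun z => F (φ z)) atBot (𝓝 (F 1)) := (hFc.tendsto 1).comp h.tendsto_atBot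
  have hle : ∀ z, E z ≤ 0 := by
    intro z
    refine le_of_forall_pos_le_add fun ε hε => ?_
    obtain ⟨N, hN⟩ := eventually_atTop.1 ((h0.eventually (gt_mem_nhds (half_pos hε))).and
      (eventually_ge_atTop z))
    obtain ⟨x, hx, hd⟩ := h.exists_deriv_small (lt_min one_pos hε) N
    have e1 := hmono (hN x hx).2
    have e2 := (hN x hx).1
    have e3 : |deriv φ x| < 1 := hd.trans_le (min_le_left _ _)
    have e4 : |deriv φ x| < ε := hd.trans_le (min_le_right _ _)
    have e5 : deriv φ x ^ 2 ≤ ε := by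
      rw [← sq_abs]; nlinarith [abs_nonneg (deriv φ x)]
    simp only [hE] at e1 ⊢
    linarith
  have : F 1 ≤ 0 := by
    refine le_of_tendsto h1 (Eventually.of_forall fun z => ?_)
    have := hle z
    simp only [hE] at this
    nlinarith [sq_nonneg (deriv φ z)]
  exact absurd hF (not_lt.2 this)

/-- A non-monotone profile has a minimum point `z₁` over a left half-line and takes the same value
again at a later `z₂`. The energy, which dissipates, cannot be smaller at `z₂`, so nothing moves in
between. -/
theorem IsFrontProfile.antitone (hf : Continuous f) (h : IsFrontProfile f c φ) (hc : 0 < c) :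
    Antitone φ := by
  have hφc : Continuous φ := h.contDiff.continuous
  by_contra hcon
  rw [Antitone] at hcon
  push Not at hcon
  obtain ⟨a, b, hab, hlt⟩ := hcon
  have hab' : a < b := lt_of_le_of_ne hab fun e => by rw [e] at hlt; exact lt_irrefl _ hlt
  -- To the left of `l`, `φ` exceeds `φ a`, so a minimum over `[min l a, b]` is a minimum over `(-∞,
  -- b]`.
  obtain ⟨l, hl⟩ := eventually_atBot.1 (h.tendsto_atBot.eventually (lt_mem_nhds (h.mem_Ioo a).2))
  obtain ⟨z₁, hz₁, hmin⟩ := isCompact_Icc.exists_isMinOn (s := Icc (min l a) b)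
    ⟨a, min_le_right _ _, hab⟩ hφc.continuousOn
  have hz₁a : φ z₁ ≤ φ a := hmin ⟨min_le_right _ _, hab⟩
  have hz₁b : z₁ < b := lt_of_le_of_ne hz₁.2 fun e => by
    rw [e] at hz₁a; exact hz₁a.not_gt hlt
  have hmin' : ∀ z ≤ b, φ z₁ ≤ φ z := fun z hz => by
    rcases le_total (min l a) z with h' | h'
    · exact hmin ⟨h', hz⟩
    · exact hz₁a.trans (hl z (h'.trans (min_le_left _ _))).le
  have hd₁ : deriv φ z₁ = 0 := by
    refine IsLocalMin.deriv_eq_zero ?_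
    filter_upwards [Iio_mem_nhds hz₁b] with z hz using hmin' z (le_of_lt hz)
  obtain ⟨d, hd⟩ := eventually_atTop.1 ((h.tendsto_atTop.eventually
    (gt_mem_nhds (h.mem_Ioo z₁).1)).and (eventually_ge_atTop b))
  obtain ⟨z₂, hz₂, he⟩ := intermediate_value_Icc' (hd d le_rfl).2 hφc.continuousOn
    ⟨(hd d le_rfl).1.le, hz₁a.trans hlt.le⟩
  have hanti : Antitone (fun z => deriv φ z ^ 2 / 2 + ∫ x in (0 : ℝ)..φ z, f x) := by
    refine antitone_of_deriv_nonpos (fun z => (h.hasDerivAt_energy hf z).differentiableAt) fun z => ?_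
    rw [(h.hasDerivAt_energy hf z).deriv]
    have := mul_nonneg hc.le (sq_nonneg (deriv φ z))
    linarith
  have hconst : ∀ z ∈ Icc z₁ z₂, deriv φ z ^ 2 / 2 + ∫ x in (0 : ℝ)..φ z, f x =
      deriv φ z₁ ^ 2 / 2 + ∫ x in (0 : ℝ)..φ z₁, f x := by
    intro z hz
    refine le_antisymm (hanti hz.1) (le_trans ?_ (hanti hz.2))
    simp only [he, hd₁]
    nlinarith [sq_nonneg (deriv φ z₂)]
  have hzero : ∀ z ∈ Ioo z₁ z₂, deriv φ z = 0 := by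
    intro z hz
    have h1 : HasDerivAt (fun z => deriv φ z ^ 2 / 2 + ∫ x in (0 : ℝ)..φ z, f x) 0 z := by
      refine (hasDerivAt_const z (deriv φ z₁ ^ 2 / 2 + ∫ x in (0 : ℝ)..φ z₁, f x)).congr_of_eventuallyEq
        ?_
      filter_upwards [isOpen_Ioo.mem_nhds hz] with x hx using hconst x (Ioo_subset_Icc_self hx)
    have h2 := h1.unique (h.hasDerivAt_energy hf z)
    have h3 : c * deriv φ z ^ 2 = 0 := by linarith
    exact pow_eq_zero_iff two_ne_zero |>.1 ((mul_eq_zero.1 h3).resolve_left hc.ne')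
  have hanti' : AntitoneOn φ (Icc z₁ z₂) := by
    apply antitoneOn_of_deriv_nonpos (convex_Icc _ _) hφc.continuousOn
    · exact fun z _ => (h.hasDerivAt z).differentiableAt.differentiableWithinAt
    · rw [interior_Icc]; exact fun z hz => (hzero z hz).le
  have := hanti' ⟨le_rfl, (hz₁b.trans_le hz₂.1).le⟩ ⟨hz₁b.le, hz₂.1⟩ hz₁b.le
  linarith

/-- Where `φ' = 0`, the nonpositive function `φ'` is maximal, so `φ'' = 0` and `f(φ) = 0`: an
equilibrium is reached, and uniqueness for the first-order system makes `φ` constant. -/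
theorem IsFrontProfile.deriv_neg (hf : IsReaction f) (h : IsFrontProfile f c φ) (hc : 0 < c)
    (z : ℝ) : deriv φ z < 0 := by
  have hanti := h.antitone hf.continuous hc
  have hnonpos : ∀ x, deriv φ x ≤ 0 := fun x => hanti.deriv_nonpos
  refine lt_of_le_of_ne (hnonpos z) fun h0 => ?_
  have hfz : f (φ z) = 0 := by
    have h1 : IsLocalMax (deriv φ) z := Eventually.of_forall fun x => by rw [h0]; exact hnonpos x
    have h2 := h1.hasDerivAt_eq_zero (h.hasDerivAt_deriv z)
    rw [h0] at h2
    linarith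
  obtain ⟨M, hM0, hM⟩ := hf.exists_lipschitz
  let v : ℝ → ℝ × ℝ → ℝ × ℝ := fun _ x => (x.2, -(c * x.2) - f x.1)
  have hv : ∀ t, LipschitzOnWith (Real.toNNReal (1 + |c| + M)) (v t) univ := by
    intro t
    refine LipschitzOnWith.of_dist_le_mul fun x _ y _ => ?_
    rw [Real.coe_toNNReal _ (by positivity)]
    have hd1 : |x.1 - y.1| ≤ dist x y := by rw [← Real.dist_eq]; exact le_max_left _ _
    have hd2 : |x.2 - y.2| ≤ dist x y := by rw [← Real.dist_eq]; exact le_max_right _ _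
    have hd0 : 0 ≤ dist x y := dist_nonneg
    refine max_le ?_ ?_
    · show dist x.2 y.2 ≤ _
      rw [Real.dist_eq]
      nlinarith [mul_nonneg (abs_nonneg c) hd0, mul_nonneg hM0 hd0]
    · show dist (-(c * x.2) - f x.1) (-(c * y.2) - f y.1) ≤ _
      rw [Real.dist_eq]
      have e : -(c * x.2) - f x.1 - (-(c * y.2) - f y.1) = -(c * (x.2 - y.2)) - (f x.1 - f y.1) := by
        ring
      rw [e]
      refine (abs_sub _ _).trans ?_
      rw [abs_neg, abs_mul]
      have := hM x.1 y.1
      nlinarith [mul_le_mul_of_nonneg_left hd2 (abs_nonneg c), mul_le_mul_of_nonneg_left hd1 hM0]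
  have heq := ODE_solution_unique_univ (v := v) (s := fun _ => univ) (t₀ := z)
    (f := fun t => (φ t, deriv φ t)) (g := fun _ => (φ z, 0)) hv
    (fun t => ⟨(h.hasDerivAt t).prodMk (h.hasDerivAt_deriv t), mem_univ _⟩)
    (fun t => ⟨by
      have : v t (φ z, 0) = 0 := by simp [v, hfz]
      rw [this]; exact hasDerivAt_const _ _, mem_univ _⟩) (by rw [h0])
  have hconst : φ = fun _ => φ z := funext fun t => congrArg Prod.fst (congrFun heq t)
  have h1 := h.tendsto_atTop
  rw [hconst] at h1
  exact (h.mem_Ioo z).1.ne' (tendsto_nhds_unique tendsto_const_nhds h1)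

/-- If `r` exceeded one of the linear bounds somewhere, `φ'` would stay below some `-κ < 0` on a
half-line, and `φ` would leave `(0,1)` in time `1 / κ`. -/
theorem IsFrontProfile.exists_isPhaseFront (hf : IsReaction f) (h : IsFrontProfile f c φ)
    (hc : 0 < c) : ∃ r, IsPhaseFront f c r := by
  have hneg := h.deriv_neg hf hc
  obtain ⟨M, hM0, hM⟩ := hf.exists_lipschitz
  obtain ⟨K, hK, hcK⟩ := exists_slope c hM0
  have hMl : ∀ x, |f x| ≤ M * |x| := fun x => by simpa [hf.map_zero] using hM x 0
  have hMr : ∀ x, |f x| ≤ M * |1 - x| := fun x => by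
    have := hM x 1
    rwa [hf.map_one, sub_zero, abs_sub_comm] at this
  have hsanti : StrictAnti φ := strictAnti_of_deriv_neg hneg
  obtain ⟨ψ, hψ, hψd⟩ := exists_hasDerivAt_inverse isOpen_univ ordConnected_univ
    (fun q _ => h.hasDerivAt q) (fun q _ => hneg q)
  have hsurj : ∀ q ∈ Ioo (0 : ℝ) 1, ∃ z, φ z = q := fun q hq => by
    obtain ⟨a, ha⟩ := (h.tendsto_atTop.eventually (gt_mem_nhds hq.1)).exists
    obtain ⟨b, hb⟩ := (h.tendsto_atBot.eventually (lt_mem_nhds hq.2)).exists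
    exact mem_range_of_exists_le_of_exists_ge h.contDiff.continuous ⟨a, ha.le⟩ ⟨b, hb.le⟩
  set r : ℝ → ℝ := fun q => -deriv φ (ψ q) with hr
  have hrφ : ∀ z, r (φ z) = -deriv φ z := fun z => by simp only [hr]; rw [hψ z (mem_univ z)]
  have hsol : IsPhaseSolution f c r (Ioo 0 1) := by
    intro q hq
    obtain ⟨z, rfl⟩ := hsurj q hq
    refine ⟨by rw [hrφ]; exact neg_pos.2 (hneg z), HasDerivAt.hasDerivWithinAt ?_⟩
    rw [hrφ]
    have h1 : HasDerivAt (deriv φ) (-(c * deriv φ z) - f (φ z)) (ψ (φ z)) := by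
      rw [hψ z (mem_univ z)]; exact h.hasDerivAt_deriv z
    refine (h1.comp _ (hψd z (mem_univ z))).neg.congr_deriv ?_
    have := (hneg z).ne
    field_simp
    ring
  have hlin : ∀ κ z, HasDerivAt (fun z => φ z + κ * z) (deriv φ z + κ) z := fun κ z => by
    exact ((h.hasDerivAt z).add ((hasDerivAt_id z).const_mul κ)).congr_deriv (by ring)
  refine ⟨_, hsol.isPhaseFront hK ?_ ?_⟩
  · intro q hq
    by_contra! hlt
    obtain ⟨z₁, rfl⟩ := hsurj q hq
    set κ := r (φ z₁) - K * φ z₁ with hκ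
    have hκ0 : 0 < κ := sub_pos.2 hlt
    have hge : ∀ z ≥ z₁, deriv φ z ≤ -κ := fun z hz => by
      have hz0 := (h.mem_Ioo z).1
      have := (hsol.mono (fun x hx => ⟨hz0.trans_le hx.1, hx.2.trans_lt hq.2⟩ :
        Icc (φ z) (φ z₁) ⊆ Ioo 0 1)).linear_le_left hf.continuous hMl hM0 hK hcK hz0.le
        (hsanti.antitone hz) hκ0 (by linarith)
      rw [hrφ] at this
      nlinarith [mul_nonneg hK.le hz0.le]
    have hanti : AntitoneOn (fun z => φ z + κ * z) (Ici z₁) := by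
      apply antitoneOn_of_deriv_nonpos (convex_Ici z₁)
      · exact fun z _ => (hlin κ z).continuousAt.continuousWithinAt
      · exact fun z _ => (hlin κ z).differentiableAt.differentiableWithinAt
      · intro z hz
        rw [interior_Ici] at hz
        rw [(hlin κ z).deriv]
        linarith [hge z (le_of_lt hz)]
    have h2 := hanti self_mem_Ici (show z₁ ≤ z₁ + κ⁻¹ by linarith [inv_pos.2 hκ0])
      (by linarith [inv_pos.2 hκ0])
    have h3 : κ * κ⁻¹ = 1 := mul_inv_cancel₀ hκ0.ne'
    simp only [mul_add, h3] at h2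
    linarith [(h.mem_Ioo z₁).2, (h.mem_Ioo (z₁ + κ⁻¹)).1]
  · intro q hq
    by_contra! hlt
    obtain ⟨z₁, rfl⟩ := hsurj q hq
    set κ := r (φ z₁) - K * (1 - φ z₁) with hκ
    have hκ0 : 0 < κ := sub_pos.2 hlt
    have hge : ∀ z ≤ z₁, deriv φ z ≤ -κ := fun z hz => by
      have hz1 := (h.mem_Ioo z).2
      have := (hsol.mono (fun x hx => ⟨hq.1.trans_le hx.1, hx.2.trans_lt hz1⟩ :
        Icc (φ z₁) (φ z) ⊆ Ioo 0 1)).linear_le_right hf.continuous hMr hM0 hK hcK hz1.le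
        (hsanti.antitone hz) hκ0 (by linarith)
      rw [hrφ] at this
      nlinarith [mul_nonneg hK.le (sub_pos.2 hz1).le]
    have hanti : AntitoneOn (fun z => φ z + κ * z) (Iic z₁) := by
      apply antitoneOn_of_deriv_nonpos (convex_Iic z₁)
      · exact fun z _ => (hlin κ z).continuousAt.continuousWithinAt
      · exact fun z _ => (hlin κ z).differentiableAt.differentiableWithinAt
      · intro z hz
        rw [interior_Iic] at hz
        rw [(hlin κ z).deriv]
        linarith [hge z (le_of_lt hz)]
    have h2 := hanti (show z₁ - κ⁻¹ ≤ z₁ by linarith [inv_pos.2 hκ0]) self_mem_Iic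
      (by linarith [inv_pos.2 hκ0])
    have h3 : κ * κ⁻¹ = 1 := mul_inv_cancel₀ hκ0.ne'
    simp only [mul_sub, h3] at h2
    linarith [(h.mem_Ioo z₁).1, (h.mem_Ioo (z₁ - κ⁻¹)).2]

/-- `r² + 2 ∫₀^q f` has derivative `2 c r > 0`, and `r` vanishes at both ends. -/
theorem IsPhaseFront.integral_pos (hf : IsReaction f) (hr : IsPhaseFront f c r) (hc : 0 < c) :
    0 < ∫ x in (0 : ℝ)..1, f x := by
  have hd : ∀ q, HasDerivAt (fun q => r q ^ 2 + 2 * ∫ x in (0 : ℝ)..q, f x) (2 * (c * r q)) q :=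
    fun q => ((hr.hasDerivAt_sq hf q).add
      ((hf.continuous.integral_hasStrictDerivAt 0 q).hasDerivAt.const_mul 2)).congr_deriv (by ring)
  have hm : StrictMonoOn (fun q => r q ^ 2 + 2 * ∫ x in (0 : ℝ)..q, f x) (Icc 0 1) := by
    apply strictMonoOn_of_deriv_pos (convex_Icc 0 1)
    · exact fun q _ => (hd q).continuousAt.continuousWithinAt
    · intro q hq
      rw [interior_Icc] at hq
      rw [(hd q).deriv]
      have := (hr.sol q hq).1
      positivity
  have := hm (left_mem_Icc.2 zero_le_one) (right_mem_Icc.2 zero_le_one) zero_lt_one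
  simp only [hr.eq_zero 0 (by simp), hr.eq_zero 1 (by simp), intervalIntegral.integral_same] at this
  linarith

end Front

/-! ### Trajectories from the two equilibria and the critical speed -/

section Critical

variable {f r : ℝ → ℝ} {c c₀ ε b q : ℝ}

theorem IsPhaseFront.nonneg (hr : IsPhaseFront f c r) (q : ℝ) : 0 ≤ r q := by
  obtain ⟨K, _, h⟩ := hr.bound
  exact (h q).1

theorem IsPhaseFront.continuous (hf : IsReaction f) (hr : IsPhaseFront f c r) : Continuous r := by
  have h : Continuous fun q => √(r q ^ 2) :=
    (continuous_iff_continuousAt.2 fun q => (hr.hasDerivAt_sq hf q).continuousAt).sqrt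
  refine h.congr fun q => Real.sqrt_sq (hr.nonneg q)

theorem IsReaction.image_sub_le (hf : IsReaction f) {a C : ℝ} (ha : 0 ≤ a)
    (h : ∀ x ∈ Ioo a 1, derivWithin f (Icc 0 1) x ≤ C) {x y : ℝ} (hx : x ∈ Icc a 1)
    (hy : y ∈ Icc a 1) (hxy : x ≤ y) : f y - f x ≤ C * (y - x) := by
  have hnhds : ∀ z ∈ Ioo a 1, Icc (0 : ℝ) 1 ∈ 𝓝 z := fun z hz =>
    Icc_mem_nhds (ha.trans_lt hz.1) hz.2
  have hd : ∀ z ∈ Ioo a 1, DifferentiableAt ℝ f z := fun z hz =>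
    ((hf.contDiffOn.differentiableOn one_ne_zero) z ⟨(ha.trans_lt hz.1).le, hz.2.le⟩).differentiableAt
      (hnhds z hz)
  refine (convex_Icc a 1).image_sub_le_mul_sub_of_deriv_le hf.continuous.continuousOn ?_ ?_ x hx y hy
    hxy
  · rw [interior_Icc]; exact fun z hz => (hd z hz).differentiableWithinAt
  · rw [interior_Icc]
    intro z hz
    rw [← derivWithin_of_mem_nhds (hnhds z hz)]
    exact h z hz

/-- If `f(p) ≤ 0` with `p` close to `1`, then `f(q) ≤ c² / 4 * (q - p)` on `[p,1]`, and the line of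
slope `c / 2` through `(p, r p)` is a subsolution. It keeps `r` above `r p` up to `1`, where `r`
must vanish. -/
theorem IsPhaseFront.exists_pos_near_one (hf : IsReaction f) (hr : IsPhaseFront f c r)
    (hc : 0 < c) : ∃ θ ∈ Ioo (0 : ℝ) 1, ∀ s ∈ Ico θ 1, 0 < f s := by
  have hd : ContinuousOn (derivWithin f (Icc 0 1)) (Icc 0 1) :=
    hf.contDiffOn.continuousOn_derivWithin (uniqueDiffOn_Icc zero_lt_one) le_rfl
  have hdt : Tendsto (derivWithin f (Icc 0 1)) (𝓝[<] 1) (𝓝 (derivWithin f (Icc 0 1) 1)) := by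
    have := (hd 1 (right_mem_Icc.2 zero_le_one)).mono Ico_subset_Icc_self
    rwa [ContinuousWithinAt, nhdsWithin_Ico_eq_nhdsLT zero_lt_one] at this
  have hclaim : ∃ a ∈ Ioo (0 : ℝ) 1, ∀ p ∈ Ico a 1, f p ≤ 0 → ∀ q ∈ Icc p 1,
      f q ≤ c ^ 2 / 4 * (q - p) := by
    have hev : ∀ {P : ℝ → Prop}, (∀ᶠ x in 𝓝[<] (1 : ℝ), P x) → ∃ a ∈ Ioo (0 : ℝ) 1, ∀ x ∈ Ioo a 1, P x := by
      intro P hP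
      obtain ⟨l, hl, hsub⟩ := mem_nhdsLT_iff_exists_Ioo_subset.1 hP
      have hl1 : l < 1 := hl
      refine ⟨max l (1 / 2), ⟨by simp, max_lt hl1 (by norm_num)⟩, fun x hx => hsub ?_⟩
      exact ⟨(le_max_left _ _).trans_lt hx.1, hx.2⟩
    -- Either `f'(1) < c² / 4` and the mean value theorem suffices, or `f'(1) > 0` and `f` increases
    -- to `f(1) = 0`, hence is nonpositive near `1`.
    rcases lt_or_ge (derivWithin f (Icc 0 1) 1) (c ^ 2 / 4) with h | h
    · obtain ⟨a, ha, hlt⟩ := hev (hdt.eventually (gt_mem_nhds h))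
      refine ⟨a, ha, fun p hp hfp q hq => ?_⟩
      have := hf.image_sub_le ha.1.le (fun x hx => (hlt x hx).le) ⟨hp.1, hp.2.le⟩
        ⟨hp.1.trans hq.1, hq.2⟩ hq.1
      linarith
    · have hpos : 0 < derivWithin f (Icc 0 1) 1 := lt_of_lt_of_le (by positivity) h
      obtain ⟨a, ha, hlt⟩ := hev (hdt.eventually (lt_mem_nhds hpos))
      refine ⟨a, ha, fun p hp _ q hq => ?_⟩
      have hmono : MonotoneOn f (Icc a 1) := by
        refine monotoneOn_Icc_of_hasDerivAt hf.continuous.continuousOn fun x hx => ?_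
        have hx0 : x ∈ Icc (0 : ℝ) 1 := ⟨(ha.1.trans hx.1).le, hx.2.le⟩
        exact ⟨_, (hlt x hx).le, ((hf.contDiffOn.differentiableOn one_ne_zero)
          x hx0).hasDerivWithinAt.hasDerivAt (Icc_mem_nhds (ha.1.trans hx.1) hx.2)⟩
      have h1 := hmono ⟨hp.1.trans hq.1, hq.2⟩ (right_mem_Icc.2 ha.2.le) hq.2
      rw [hf.map_one] at h1
      have : 0 ≤ c ^ 2 / 4 * (q - p) := mul_nonneg (by positivity) (sub_nonneg.2 hq.1)
      linarith
  by_contra! hcon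
  obtain ⟨a, ha, hcl⟩ := hclaim
  obtain ⟨p, hp, hfp⟩ := hcon a ha
  obtain ⟨K, hK, hb⟩ := hr.bound
  have hp0 : 0 < p := ha.1.trans_le hp.1
  have hκ : 0 < r p := (hr.sol p ⟨hp0, hp.2⟩).1
  have hge : ∀ b ∈ Ico p 1, r p ≤ r b := by
    intro b hbp
    have hB : IsPhaseSub f c (fun q => c / 2 * (q - p) + r p) (Icc p b) := by
      intro q hq
      have h0 : 0 ≤ c / 2 * (q - p) := mul_nonneg (by positivity) (sub_nonneg.2 hq.1)
      have hpos : 0 < c / 2 * (q - p) + r p := by linarith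
      refine ⟨hpos, c / 2, ?_, ?_⟩
      · have : f q / (c / 2 * (q - p) + r p) ≤ c / 2 := by
          rw [div_le_iff₀ hpos]
          have h1 := hcl p hp hfp q ⟨hq.1, hq.2.trans hbp.2.le⟩
          nlinarith [mul_pos hc hκ]
        linarith
      · simpa using ((((hasDerivAt_id q).sub_const p).const_mul (c / 2)).add_const
          (r p)).hasDerivWithinAt
    have hs : Icc p b ⊆ Ioo 0 1 := fun q hq => ⟨hp0.trans_le hq.1, hq.2.trans_lt hbp.2⟩
    have h1 := hB.le_of_le hbp.1 hf.continuous.continuousOn ((hr.sol.mono hs).super le_rfl)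
      (by simp)
    have h2 : 0 ≤ c / 2 * (b - p) := mul_nonneg (by positivity) (sub_nonneg.2 hbp.1)
    linarith
  have h1 : max p (1 - r p / (2 * K)) < 1 := max_lt hp.2 (by
    have : 0 < r p / (2 * K) := by positivity
    linarith)
  have h2 := hge _ ⟨le_max_left _ _, h1⟩
  have h3 := (hb (max p (1 - r p / (2 * K)))).2.2
  rw [abs_of_pos (sub_pos.2 h1)] at h3
  have h4 : K * (1 - max p (1 - r p / (2 * K))) ≤ K * (r p / (2 * K)) :=
    mul_le_mul_of_nonneg_left (by linarith [le_max_right p (1 - r p / (2 * K))]) hK.le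
  have h5 : K * (r p / (2 * K)) = r p / 2 := by field_simp
  linarith

theorem awTrajectory_of_isPhaseSub {B g : ℝ → ℝ} (hg : Continuous g) (hb : 0 ≤ b)
    (hB : IsPhaseSub g c B (Icc 0 b)) (h0 : B 0 ≤ ε) :
    awTrajectory g c ε b < 0 ∧ B b ≤ -awTrajectory g c ε b := by
  obtain ⟨ρ, hρ, hρ0⟩ := hB.exists_solution hg hb h0
  have hbm := right_mem_Icc.2 hb
  rw [hρ.awTrajectory_eq hg hρ0 hbm, neg_neg]
  exact ⟨neg_lt_zero.2 (hρ b hbm).1,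
    hB.le_of_le hb hg.continuousOn (hρ.super le_rfl) (by rwa [hρ0])⟩

/-- `√(r² + ε²)` starts from `ε` and is a subsolution for every `c ≥ c₀`, since `c₀ r ≤ c √(r² +
ε²)`. It is positive for all `b ≥ 0`, also beyond `1`. -/
theorem IsPhaseFront.awTrajectory_neg (hf : IsReaction f) (hr : IsPhaseFront f c₀ r) (h0 : 0 ≤ c₀)
    (hc : c₀ ≤ c) (hε : 0 < ε) (hb : 0 ≤ b) :
    awTrajectory f c ε b < 0 ∧ r b ≤ -awTrajectory f c ε b := by
  have hle : ∀ q, r q ≤ √(r q ^ 2 + ε ^ 2) := fun q =>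
    Real.le_sqrt_of_sq_le (by linarith [sq_nonneg ε])
  have hB : IsPhaseSub f c (fun q => √(r q ^ 2 + ε ^ 2)) (Icc 0 b) := by
    refine isPhaseSub_sqrt (Y' := fun q => 2 * (c₀ * r q - f q)) (fun q _ => by positivity)
      (fun q _ => ((hr.hasDerivAt_sq hf q).add_const _).hasDerivWithinAt) fun q _ => ?_
    have h1 := mul_le_mul hc (hle q) (hr.nonneg q) (h0.trans hc)
    linarith
  obtain ⟨h1, h2⟩ := awTrajectory_of_isPhaseSub (ε := ε) hf.continuous hb hB
    (by simp [hr.eq_zero 0 (by simp), Real.sqrt_sq hε.le])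
  exact ⟨h1, (hle b).trans h2⟩

/-- A front with speed `c₀` prevents the trajectories with larger speeds from reaching `(1,0)`. -/
theorem IsPhaseFront.awLimit_neg (hf : IsReaction f) (hr : IsPhaseFront f c₀ r) (h0 : 0 < c₀)
    (hc : c₀ < c) : awLimit f c 1 < 0 := by
  obtain ⟨θ, hθ, hfθ⟩ := hr.exists_pos_near_one hf h0
  have hpos : 0 < (c - c₀) * (1 - θ) := mul_pos (sub_pos.2 hc) (sub_pos.2 hθ.2)
  refine (awLimit_le hf.continuous zero_le_one fun ε hε => ?_).trans_lt (neg_lt_zero.2 hpos)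
  have hneg := fun b (hb : 0 ≤ b) => hr.awTrajectory_neg hf h0.le hc.le hε hb
  have hsol := isPhaseSolution_awTrajectory hf.continuous (hneg 1 zero_le_one).1
  have hs : Icc θ 1 ⊆ Icc 0 1 := Icc_subset_Icc_left hθ.1.le
  -- In `[θ,1)`, where `f > 0`, a trajectory `ρ ≥ r` satisfies `(ρ - r)' = c - c₀ + f / r - f / ρ ≥
  -- c - c₀`: the gap at `1` is bounded below independently of `ε`.
  have hmono : MonotoneOn (fun q => -awTrajectory f c ε q - r q - (c - c₀) * q) (Icc θ 1) := by
    refine monotoneOn_Icc_of_hasDerivAt (((hsol.continuousOn.mono hs).sub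
      (hr.continuous hf).continuousOn).sub (continuous_const.mul continuous_id).continuousOn) ?_
    intro q hq
    have hq0 : 0 < q := hθ.1.trans hq.1
    have hq1 : q ∈ Ioo (0 : ℝ) 1 := ⟨hq0, hq.2⟩
    obtain ⟨a1, a2⟩ := hsol q ⟨hq0.le, hq.2.le⟩
    obtain ⟨b1, b2⟩ := hr.sol q hq1
    refine ⟨_, ?_, ((a2.hasDerivAt (Icc_mem_nhds hq0 hq.2)).sub
      (b2.hasDerivAt (isOpen_Ioo.mem_nhds hq1))).sub ((hasDerivAt_id q).const_mul (c - c₀))⟩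
    have := div_le_div_of_nonneg_left (hfθ q ⟨hq.1.le, hq.2⟩).le b1 (hneg q hq0.le).2
    simp only
    linarith
  have h1 := hmono (left_mem_Icc.2 hθ.2.le) (right_mem_Icc.2 hθ.2.le) hθ.2.le
  simp only [hr.eq_zero 1 (by simp)] at h1
  linarith [(hneg θ hθ.1.le).2]

theorem hasDerivAt_max_zero_sq (x : ℝ) : HasDerivAt (fun x : ℝ => max x 0 ^ 2) (2 * max x 0) x := by
  rcases lt_trichotomy x 0 with h | rfl | h
  · rw [max_eq_right h.le, mul_zero]
    refine (hasDerivAt_const x (0 : ℝ)).congr_of_eventuallyEq ?_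
    filter_upwards [Iio_mem_nhds h] with y hy
    rw [max_eq_right (le_of_lt hy)]; simp
  · rw [max_self, mul_zero]
    refine hasDerivAt_zero_of_le_sq (C := 1) fun x => ?_
    rw [abs_of_nonneg (sq_nonneg _), one_mul, sub_zero]
    exact pow_le_pow_left₀ (le_max_right _ _) (max_le (le_abs_self _) (abs_nonneg _)) 2
  · rw [max_eq_left h.le]
    refine HasDerivAt.congr_of_eventuallyEq (f := fun y => y ^ 2) ?_ ?_
    · simpa using hasDerivAt_pow 2 x
    · filter_upwards [Ioi_mem_nhds h] with y hy
      rw [max_eq_left (le_of_lt hy)]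

/-- The trajectory which emerges from `(1,0)`, as a limit of the trajectories emerging from
`(1,-ε)`. -/
noncomputable def unstableTrajectory (f : ℝ → ℝ) (c q : ℝ) : ℝ :=
  -awLimit (fun x => -f (1 - x)) (-c) (1 - q)

theorem continuous_reflection (hf : Continuous f) (k : ℝ) : Continuous fun x => -f (k - x) :=
  (hf.comp (continuous_const.sub continuous_id)).neg

/-- After the reflection the speed is `-c < 0`, and adding the constant `ε²` to `r²` no longer gives
a subsolution. It is replaced by `m²` with `m = max (ε - c x) 0`, whose decay compensates the term
`c m` in `c √(r² + m²) ≤ c₀ r + c m`. -/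
theorem IsPhaseFront.reflected_awTrajectory_neg (hf : IsReaction f) (hr : IsPhaseFront f c₀ r)
    (hc0 : 0 < c) (hc : c ≤ c₀) (hε : 0 < ε) (hq : q ∈ Ioc (0 : ℝ) 1) :
    awTrajectory (fun x => -f (1 - x)) (-c) ε (1 - q) < 0 ∧
      r q ≤ -awTrajectory (fun x => -f (1 - x)) (-c) ε (1 - q) := by
  set m : ℝ → ℝ := fun x => max (ε - c * x) 0 with hm
  have hm0 : ∀ x, 0 ≤ m x := fun x => le_max_right _ _
  have hmd : ∀ x, HasDerivAt (fun x => m x ^ 2) (2 * m x * (-c)) x := fun x => by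
    have h1 : HasDerivAt (fun x => ε - c * x) (-c) x := by
      simpa using ((hasDerivAt_id x).const_mul c).const_sub ε
    exact (hasDerivAt_max_zero_sq (ε - c * x)).comp x h1
  have hrd : ∀ x, HasDerivAt (fun x => r (1 - x) ^ 2) (-(2 * (c₀ * r (1 - x) - f (1 - x)))) x :=
    fun x => by
      have h1 := (hr.hasDerivAt_sq hf (1 - x)).comp x ((hasDerivAt_id x).const_sub 1)
      exact h1.congr_deriv (by simp)
  have hB : IsPhaseSub (fun x => -f (1 - x)) (-c) (fun x => √(r (1 - x) ^ 2 + m x ^ 2))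
      (Icc 0 (1 - q)) := by
    refine isPhaseSub_sqrt (fun x hx => ?_)
      (fun x _ => ((hrd x).add (hmd x)).hasDerivWithinAt) fun x _ => ?_
    · rcases hx.1.eq_or_lt with rfl | h
      · have : 0 < m 0 := by simp [hm, hε]
        positivity
      · have := (hr.sol (1 - x) ⟨by linarith [hx.2, hq.1], by linarith⟩).1
        positivity
    · have h1 : √(r (1 - x) ^ 2 + m x ^ 2) ≤ r (1 - x) + m x := by
        rw [Real.sqrt_le_left (add_nonneg (hr.nonneg _) (hm0 x))]
        nlinarith [mul_nonneg (hr.nonneg (1 - x)) (hm0 x)]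
      have h2 := mul_le_mul_of_nonneg_left h1 hc0.le
      have h3 := mul_le_mul_of_nonneg_right hc (hr.nonneg (1 - x))
      linarith
  obtain ⟨h1, h2⟩ := awTrajectory_of_isPhaseSub (ε := ε) (continuous_reflection hf.continuous 1)
    (sub_nonneg.2 hq.2) hB (by simp [hr.eq_zero 1 (by simp), hm, max_eq_left hε.le, Real.sqrt_sq hε.le])
  refine ⟨h1, le_trans ?_ h2⟩
  simp only [sub_sub_cancel]
  exact Real.le_sqrt_of_sq_le (by linarith [sq_nonneg (m (1 - q))])

theorem IsPhaseFront.le_unstableTrajectory (hf : IsReaction f) (hr : IsPhaseFront f c₀ r)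
    (hc0 : 0 < c) (hc : c ≤ c₀) (hq : q ∈ Ioc (0 : ℝ) 1) : r q ≤ unstableTrajectory f c q := by
  rw [unstableTrajectory, le_neg]
  refine awLimit_le (continuous_reflection hf.continuous 1) (sub_nonneg.2 hq.2) fun ε hε => ?_
  rw [le_neg]
  exact (hr.reflected_awTrajectory_neg hf hc0 hc hε hq).2

theorem unstableTrajectory_anti (hf : Continuous f) {c' : ℝ} (hc : c ≤ c') (hq : q ≤ 1) :
    unstableTrajectory f c' q ≤ unstableTrajectory f c q :=
  neg_le_neg (awLimit_anti (continuous_reflection hf 1) (neg_le_neg hc) (sub_nonneg.2 hq))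

theorem unstableTrajectory_le {M K : ℝ} (hf : Continuous f) (hM : ∀ x, |f x| ≤ M * |1 - x|)
    (hM0 : 0 ≤ M) (hK : 0 < K) (hcK : |c| + M / K ≤ K) (hq : q ≤ 1) :
    unstableTrajectory f c q ≤ K * (1 - q) := by
  refine neg_awLimit_le (M := M) (continuous_reflection hf 1) (fun x hx => ?_) hM0 hK
    (by linarith [neg_abs_le c]) (sub_nonneg.2 hq)
  have := hM (1 - x)
  rw [sub_sub_cancel, abs_of_nonneg hx.1] at this
  linarith [le_abs_self (f (1 - x))]

theorem IsPhaseSolution.of_reflect {ρ : ℝ → ℝ} (k : ℝ) {s : Set ℝ}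
    (h : IsPhaseSolution (fun x => -f (k - x)) (-c) ρ s) :
    IsPhaseSolution f c (fun q => ρ (k - q)) ((fun q => k - q) ⁻¹' s) := by
  have := h.reflect k
  simpa only [sub_sub_cancel, neg_neg] using this

theorem IsPhaseFront.isPhaseSolution_unstableTrajectory (hf : IsReaction f)
    (hr : IsPhaseFront f c₀ r) (hc0 : 0 < c) (hc : c ≤ c₀) :
    IsPhaseSolution f c (unstableTrajectory f c) (Ioo 0 1) := by
  intro q hq
  have hneg : ∀ x ∈ Ioo (0 : ℝ) (1 - q / 2), awLimit (fun x => -f (1 - x)) (-c) x < 0 := by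
    intro x hx
    have hx' : 1 - x ∈ Ioo (0 : ℝ) 1 := ⟨by linarith [hx.2, hq.1], by linarith [hx.1]⟩
    have h1 := hr.le_unstableTrajectory hf hc0 hc (Ioo_subset_Ioc_self hx')
    rw [unstableTrajectory, sub_sub_cancel] at h1
    linarith [(hr.sol _ hx').1]
  have hq2 : q / 2 ∈ Ioc (0 : ℝ) 1 := ⟨half_pos hq.1, by linarith [hq.2, hq.1]⟩
  have h1 := isPhaseSolution_awLimit (continuous_reflection hf.continuous 1)
    (by linarith [hq2.2] : 0 ≤ 1 - q / 2)
    (fun ε hε => (hr.reflected_awTrajectory_neg hf hc0 hc hε hq2).1) Ioo_subset_Icc_self hneg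
  obtain ⟨h2, h3⟩ := h1.of_reflect (f := f) 1 q
    ⟨by show 0 < 1 - q; linarith [hq.2], by show 1 - q < 1 - q / 2; linarith [hq.1]⟩
  refine ⟨h2, (h3.hasDerivAt ?_).hasDerivWithinAt⟩
  refine (isOpen_Ioo.preimage (continuous_const.sub continuous_id)).mem_nhds ?_
  exact ⟨by show 0 < 1 - q; linarith [hq.2], by show 1 - q < 1 - q / 2; linarith [hq.1]⟩

/-- If the trajectories emerging from `(0,-ε)` stay away from `(1,0)`, the trajectory emerging
from `(1,0)` ends at `(0,0)`. -/
theorem IsPhaseFront.unstableTrajectory_le_left {M K : ℝ} (hf : IsReaction f)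
    (hr : IsPhaseFront f c₀ r)
    (hM : ∀ x, |f x| ≤ M * |x|) (hM0 : 0 ≤ M) (hK : 0 < K) (hcK : |c| + M / K ≤ K)
    (hc0 : 0 < c) (hc : c ≤ c₀) (hlim : awLimit f c 1 < 0) (hq : q ∈ Ioo (0 : ℝ) 1) :
    unstableTrajectory f c q ≤ K * q := by
  -- At `q = 1` the trajectories from `(0,-ε)` have height at least `2 δ`, above the starting point
  -- of the backward trajectory from `(1,-δ)`.
  set δ := -awLimit f c 1 / 2 with hδ
  have hδ0 : 0 < δ := half_pos (neg_pos.2 hlim)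
  have hcont := continuous_reflection hf.continuous 1
  obtain ⟨hs, -⟩ := hr.reflected_awTrajectory_neg hf hc0 hc hδ0 (Ioo_subset_Ioc_self hq)
  have hs1 := (isPhaseSolution_awTrajectory hcont hs).of_reflect (f := f) 1
  have hsub : Icc q 1 ⊆ (fun x => 1 - x) ⁻¹' Icc 0 (1 - q) := fun x hx =>
    ⟨sub_nonneg.2 hx.2, sub_le_sub_left hx.1 1⟩
  have h1 : unstableTrajectory f c q ≤ -awTrajectory (fun x => -f (1 - x)) (-c) δ (1 - q) :=
    neg_le_neg (awTrajectory_le_awLimit hcont hδ0 (sub_nonneg.2 hq.2.le))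
  refine h1.trans (le_of_forall_pos_le_add fun ε hε => ?_)
  have haw := awTrajectory_le_awLimit (c := c) hf.continuous hε zero_le_one
  have hρ := isPhaseSolution_awTrajectory hf.continuous (haw.trans_lt hlim)
  have h2 := neg_awTrajectory_le (c := c) (q := q) hf.continuous (fun x hx => by
    have := hM x
    rw [abs_of_nonneg hx.1] at this
    linarith [neg_abs_le (f x)]) hM0 hK (by linarith [le_abs_self c]) hε hq.1.le
  -- The opposite order at `q` would propagate to `1`, against the choice of `δ`.
  have h3 : -awTrajectory (fun x => -f (1 - x)) (-c) δ (1 - q) ≤ -awTrajectory f c ε q := by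
    by_contra! hlt
    have h4 := ((hρ.mono (Icc_subset_Icc_left hq.1.le)).sub le_rfl).lt_of_lt hq.2.le
      hf.continuous.continuousOn ((hs1.mono hsub).super le_rfl) hlt
    simp only [sub_self] at h4
    rw [awTrajectory_zero hcont hδ0] at h4
    linarith
  linarith

/-- Since `(ρ² + 2 ∫₀^q f)' = 2 c ρ` and `ρ ≤ ε + K`, crossing from `0` to `1` costs a speed
proportional to `∫₀¹ f`. This keeps the critical speed positive. -/
theorem awLimit_one_neg_speed_bound {M K : ℝ} (hf : IsReaction f)
    (hM : ∀ x, |f x| ≤ M * |x|) (hM0 : 0 ≤ M) (hK : 0 < K) (hcK : c + M / K ≤ K)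
    (hlim : awLimit f c 1 < 0) : ∫ x in (0 : ℝ)..1, f x ≤ max c 0 * K := by
  have key : ∀ ε > 0, 2 * ∫ x in (0 : ℝ)..1, f x ≤ ε ^ 2 + 2 * max c 0 * (ε + K) := by
    intro ε hε
    have haw := awTrajectory_le_awLimit (c := c) hf.continuous hε zero_le_one
    have hρ := isPhaseSolution_awTrajectory hf.continuous (haw.trans_lt hlim)
    have hFd := fun q => (hf.continuous.integral_hasStrictDerivAt 0 q).hasDerivAt
    have hle : ∀ q ∈ Icc (0 : ℝ) 1, -awTrajectory f c ε q ≤ ε + K := fun q hq => by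
      have h2 := neg_awTrajectory_le (c := c) (q := q) hf.continuous (fun x hx => by
        have := hM x
        rw [abs_of_nonneg hx.1] at this
        linarith [neg_abs_le (f x)]) hM0 hK hcK hε hq.1
      have := mul_le_mul_of_nonneg_left hq.2 hK.le
      linarith
    have hmono : MonotoneOn (fun q => 2 * max c 0 * (ε + K) * q - ((-awTrajectory f c ε q) ^ 2 +
        2 * ∫ x in (0 : ℝ)..q, f x)) (Icc 0 1) := by
      apply monotoneOn_Icc_of_hasDerivAt
      · refine (continuous_const.mul continuous_id).continuousOn.sub
          ((hρ.continuousOn.pow 2).add (Continuous.continuousOn ?_))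
        exact continuous_const.mul (continuous_iff_continuousAt.2 fun q => (hFd q).continuousAt)
      · intro q hq
        have hq' := Ioo_subset_Icc_self hq
        refine ⟨_, ?_, ((hasDerivAt_id q).const_mul _).sub (((hρ.hasDerivWithinAt_sq hq').hasDerivAt
          (Icc_mem_nhds hq.1 hq.2)).add ((hFd q).const_mul 2))⟩
        have h0 := (hρ q hq').1
        have h1 : c * -awTrajectory f c ε q ≤ max c 0 * (ε + K) :=
          mul_le_mul (le_max_left _ _) (hle q hq') h0.le (le_max_right _ _)
        linarith
    have := hmono (left_mem_Icc.2 zero_le_one) (right_mem_Icc.2 zero_le_one) zero_le_one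
    simp only [awTrajectory_zero hf.continuous hε, intervalIntegral.integral_same] at this
    nlinarith [sq_nonneg (awTrajectory f c ε 1)]
  have hlim' : Tendsto (fun ε : ℝ => ε ^ 2 + 2 * max c 0 * (ε + K)) (𝓝[>] 0)
      (𝓝 (0 ^ 2 + 2 * max c 0 * (0 + K))) := by
    have : Continuous fun ε : ℝ => ε ^ 2 + 2 * max c 0 * (ε + K) := by fun_prop
    exact (this.tendsto 0).mono_left nhdsWithin_le_nhds
  have h1 := ge_of_tendsto hlim' (by
    filter_upwards [self_mem_nhdsWithin] with ε hε using key ε hε)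
  linarith

/-- For speeds `c` in `(s, c₀)` the trajectory from `(1,0)` satisfies `r ≤ K q`, with `K`
independent of `c`; letting `c ↘ s` preserves the bound, which makes the trajectory of speed `s` a
front. -/
theorem IsPhaseFront.exists_critical (hf : IsReaction f) (hr : IsPhaseFront f c₀ r) (h0 : 0 < c₀) :
    ∃ s, 0 < s ∧ (∃ r', IsPhaseFront f s r') ∧ IsGLB {c : ℝ | awLimit f c 1 < 0} s := by
  obtain ⟨M, hM0, hM⟩ := hf.exists_lipschitz
  obtain ⟨K, hK, hcK⟩ := exists_slope c₀ hM0
  have hMl : ∀ x, |f x| ≤ M * |x| := fun x => by simpa [hf.map_zero] using hM x 0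
  have hMr : ∀ x, |f x| ≤ M * |1 - x| := fun x => by
    have := hM x 1
    rwa [hf.map_one, sub_zero, abs_sub_comm] at this
  have hint := hr.integral_pos hf h0
  set A : Set ℝ := {c : ℝ | awLimit f c 1 < 0} with hA
  have hlow : ∀ c ∈ A, min c₀ ((∫ x in (0 : ℝ)..1, f x) / K) ≤ c := by
    intro c hc
    rcases le_total c c₀ with h | h
    · have h1 := awLimit_one_neg_speed_bound hf hMl hM0 hK (by linarith [le_abs_self c₀]) hc
      refine (min_le_right _ _).trans ?_
      rw [div_le_iff₀ hK]
      rcases le_total c 0 with h2 | h2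
      · rw [max_eq_right h2, zero_mul] at h1; exact absurd hint h1.not_gt
      · rwa [max_eq_left h2] at h1
    · exact (min_le_left _ _).trans h
  have hne : A.Nonempty := ⟨c₀ + 1, hr.awLimit_neg hf h0 (by linarith)⟩
  have hbdd : BddBelow A := ⟨_, hlow⟩
  have hglb : IsGLB A (sInf A) := isGLB_csInf hne hbdd
  have hspos : 0 < sInf A := lt_of_lt_of_le (lt_min h0 (div_pos hint hK)) (le_csInf hne hlow)
  have hmem : ∀ c > sInf A, c ∈ A := fun c hc => by
    obtain ⟨c', hc', hlt⟩ := exists_lt_of_csInf_lt hne hc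
    exact (awLimit_anti hf.continuous hlt.le zero_le_one).trans_lt hc'
  have hsle : sInf A ≤ c₀ := le_of_forall_gt_imp_ge_of_dense fun c hc =>
    csInf_le hbdd (hr.awLimit_neg hf h0 hc)
  refine ⟨sInf A, hspos, ?_, hglb⟩
  rcases hsle.eq_or_lt with h | hslt
  · rw [h]; exact ⟨r, hr⟩
  set s := sInf A with hs
  have hsK : ∀ c, 0 < c → c ≤ c₀ → |c| + M / K ≤ K := fun c h1 h2 => by
    rw [abs_of_pos h1]; linarith [le_abs_self c₀]
  have hsol := fun c (h1 : 0 < c) (h2 : c ≤ c₀) => hr.isPhaseSolution_unstableTrajectory hf h1 h2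
  have hright : ∀ q ∈ Ioo (0 : ℝ) 1, unstableTrajectory f s q ≤ K * (1 - q) := fun q hq =>
    unstableTrajectory_le hf.continuous hMr hM0 hK (hsK s hspos hsle) hq.2.le
  refine ⟨_, (hsol s hspos hsle).isPhaseFront hK (fun q hq => ?_) hright⟩
  have hsq : unstableTrajectory f s q ^ 2 ≤ (K * q) ^ 2 := by
    -- The squares for the speeds `s` and `c` satisfy `(u_s² - u_c²)' ≥ -2 (c - s) u_c`, and both
    -- tend to `0` at `q = 1`; integrating from `q` to `b` and letting `b → 1` compares them at `q`.
    have hc : ∀ c ∈ Ioo s c₀, unstableTrajectory f s q ^ 2 ≤ (K * q) ^ 2 + 2 * ((c - s) * K) := by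
      intro c hc
      have hcpos := hspos.trans hc.1
      have hleft : ∀ x ∈ Ioo (0 : ℝ) 1, unstableTrajectory f c x ≤ K * x := fun x hx =>
        hr.unstableTrajectory_le_left hf hMl hM0 hK (hsK c hcpos hc.2.le) hcpos hc.2.le
          (hmem c hc.1) hx
      have h1 : ∀ b ∈ Ioo q 1, unstableTrajectory f s q ^ 2 ≤
          (K * q) ^ 2 + (K * (1 - b)) ^ 2 + 2 * ((c - s) * K) := by
        intro b hb
        have hsub : Icc q b ⊆ Ioo 0 1 := fun x hx => ⟨hq.1.trans_le hx.1, hx.2.trans_lt hb.2⟩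
        have hmono : MonotoneOn (fun x => unstableTrajectory f s x ^ 2 -
            unstableTrajectory f c x ^ 2 + 2 * ((c - s) * K) * x) (Icc q b) := by
          apply monotoneOn_Icc_of_hasDerivAt
          · exact ((((hsol s hspos hsle).continuousOn.mono hsub).pow 2).sub
              (((hsol c hcpos hc.2.le).continuousOn.mono hsub).pow 2)).add
              (continuous_const.mul continuous_id).continuousOn
          · intro x hx
            have hx' := hsub (Ioo_subset_Icc_self hx)
            have hn := isOpen_Ioo.mem_nhds hx'
            refine ⟨_, ?_, ((((hsol s hspos hsle).hasDerivWithinAt_sq hx').hasDerivAt hn).sub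
              (((hsol c hcpos hc.2.le).hasDerivWithinAt_sq hx').hasDerivAt hn)).add
              ((hasDerivAt_id x).const_mul _)⟩
            have e1 : unstableTrajectory f c x ≤ unstableTrajectory f s x :=
              unstableTrajectory_anti hf.continuous hc.1.le hx'.2.le
            have e2 : unstableTrajectory f c x ≤ K :=
              (hleft x hx').trans (mul_le_of_le_one_right hK.le hx'.2.le)
            have e3 := mul_le_mul_of_nonneg_left e1 hspos.le
            have e4 := mul_le_mul_of_nonneg_left e2 (sub_pos.2 hc.1).le
            nlinarith
        have h2 := hmono (left_mem_Icc.2 hb.1.le) (right_mem_Icc.2 hb.1.le) hb.1.le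
        have hbI : b ∈ Ioo (0 : ℝ) 1 := ⟨hq.1.trans hb.1, hb.2⟩
        have h3 : unstableTrajectory f s b ^ 2 ≤ (K * (1 - b)) ^ 2 :=
          pow_le_pow_left₀ ((hsol s hspos hsle) b hbI).1.le (hright b hbI) 2
        have h4 : unstableTrajectory f c q ^ 2 ≤ (K * q) ^ 2 :=
          pow_le_pow_left₀ ((hsol c hcpos hc.2.le) q hq).1.le (hleft q hq) 2
        have h5 : 0 < (c - s) * K := mul_pos (sub_pos.2 hc.1) hK
        simp only at h2
        nlinarith [sq_nonneg (unstableTrajectory f c b), mul_nonneg h5.le hq.1.le,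
          mul_nonneg h5.le (sub_nonneg.2 hb.2.le)]
      have hlim : Tendsto (fun b : ℝ => (K * q) ^ 2 + (K * (1 - b)) ^ 2 + 2 * ((c - s) * K))
          (𝓝[<] 1) (𝓝 ((K * q) ^ 2 + (K * (1 - 1)) ^ 2 + 2 * ((c - s) * K))) := by
        have : Continuous fun b : ℝ => (K * q) ^ 2 + (K * (1 - b)) ^ 2 + 2 * ((c - s) * K) := by
          fun_prop
        exact (this.tendsto 1).mono_left nhdsWithin_le_nhds
      have := ge_of_tendsto hlim (by
        filter_upwards [Ioo_mem_nhdsLT hq.2] with b hb using h1 b hb)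
      simpa using this
    have hlim : Tendsto (fun c : ℝ => (K * q) ^ 2 + 2 * ((c - s) * K)) (𝓝[>] s)
        (𝓝 ((K * q) ^ 2 + 2 * ((s - s) * K))) := by
      have : Continuous fun c : ℝ => (K * q) ^ 2 + 2 * ((c - s) * K) := by fun_prop
      exact (this.tendsto s).mono_left nhdsWithin_le_nhds
    have := ge_of_tendsto hlim (by
      filter_upwards [Ioo_mem_nhdsGT hslt] with c hc' using hc c hc')
    simpa using this
  exact (pow_le_pow_iff_left₀ ((hsol s hspos hsle) q hq).1.le (mul_nonneg hK.le hq.1.le)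
    two_ne_zero).1 hsq

end Critical

/-! ### Upper profiles for supercritical speeds -/

section Upper

variable {f r : ℝ → ℝ} {c s b q : ℝ}

theorem IsReaction.tendsto_div (hf : IsReaction f) :
    Tendsto (fun q => f q / q) (𝓝[>] 0) (𝓝 (derivWithin f (Icc 0 1) 0)) := by
  have h1 : HasDerivWithinAt f (derivWithin f (Icc 0 1) 0) (Icc 0 1) 0 :=
    (hf.contDiffOn.differentiableOn one_ne_zero 0 (left_mem_Icc.2 zero_le_one)).hasDerivWithinAt
  have h2 : HasDerivWithinAt f (derivWithin f (Icc 0 1) 0) (Ioi 0) 0 :=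
    h1.mono_of_mem_nhdsWithin (mem_of_superset (Ioo_mem_nhdsGT zero_lt_one) Ioo_subset_Icc_self)
  have h3 := (hasDerivWithinAt_iff_tendsto_slope' (self_notMem_Ioi)).1 h2
  refine h3.congr fun q => ?_
  rw [slope_def_field, hf.map_zero, sub_zero, sub_zero]

theorem exists_Ioo_of_eventually_nhdsGT {P : ℝ → Prop} (h : ∀ᶠ x in 𝓝[>] (0 : ℝ), P x) :
    ∃ a ∈ Ioo (0 : ℝ) 1, ∀ x ∈ Ioc 0 a, P x := by
  obtain ⟨u, hu, hsub⟩ := mem_nhdsGT_iff_exists_Ioo_subset.1 h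
  have hu0 : 0 < u := hu
  refine ⟨min (u / 2) (1 / 2), ⟨by positivity, (min_le_right _ _).trans_lt (by norm_num)⟩,
    fun x hx => hsub ⟨hx.1, ?_⟩⟩
  exact (hx.2.trans (min_le_left _ _)).trans_lt (half_lt_self hu0)

/-- The speed of a front is not smaller than the one of the linearized equation at `0`. -/
theorem IsPhaseFront.four_mul_deriv_le (hf : IsReaction f) (hr : IsPhaseFront f c r)
    (hc : 0 < c) : 4 * derivWithin f (Icc 0 1) 0 ≤ c ^ 2 := by
  by_contra! hlt
  obtain ⟨m, hm1, hm2⟩ := exists_between (show c ^ 2 / 4 < derivWithin f (Icc 0 1) 0 by linarith)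
  have hm0 : 0 < m := lt_of_le_of_lt (by positivity) hm1
  obtain ⟨a, ha, hfa⟩ := exists_Ioo_of_eventually_nhdsGT (hf.tendsto_div.eventually (lt_mem_nhds hm2))
  obtain ⟨K, hK, hb⟩ := hr.bound
  have hsm : √m ^ 2 = m := Real.sq_sqrt hm0.le
  have hsm0 : 0 < √m := Real.sqrt_pos.2 hm0
  set κ := 2 * √m - c with hκ
  have hκ0 : 0 < κ := by
    have : c < 2 * √m := lt_of_pow_lt_pow_left₀ 2 (by positivity) (by rw [mul_pow, hsm]; linarith)
    linarith
  -- If `f ≥ m q`, then `w = r / q` satisfies `q w' = c - f / r - w ≤ c - m / w - w ≤ c - 2 √m =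
  -- -κ`. So `w` grows like `-κ log q` as `q → 0`, against `w ≤ K`.
  have hmono : ∀ q ∈ Ioo 0 a, r a / a + κ * Real.log a ≤ r q / q + κ * Real.log q := by
    intro q hq
    have hsub : Icc q a ⊆ Ioo 0 1 := fun x hx => ⟨hq.1.trans_le hx.1, hx.2.trans_lt ha.2⟩
    have hd : ∀ x ∈ Icc q a, HasDerivAt (fun x => -(r x / x + κ * Real.log x))
        (-(((c - f x / r x) * x - r x * 1) / x ^ 2 + κ * x⁻¹)) x := fun x hx => by
      have hx0 := (hsub hx).1
      exact ((((hr.sol x (hsub hx)).2.hasDerivAt (isOpen_Ioo.mem_nhds (hsub hx))).div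
        (hasDerivAt_id x) hx0.ne').add ((Real.hasDerivAt_log hx0.ne').const_mul κ)).neg
    have := monotoneOn_Icc_of_hasDerivAt (fun x hx => (hd x hx).continuousAt.continuousWithinAt)
      (fun x hx => ⟨_, ?_, hd x (Ioo_subset_Icc_self hx)⟩) (left_mem_Icc.2 hq.2.le)
      (right_mem_Icc.2 hq.2.le) hq.2.le
    · simp only at this; linarith
    · have hx0 := (hsub (Ioo_subset_Icc_self hx)).1
      have hrx := (hr.sol x (hsub (Ioo_subset_Icc_self hx))).1
      have h1 := hfa x ⟨hx0, hx.2.le⟩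
      rw [lt_div_iff₀ hx0] at h1
      have h2 : -(((c - f x / r x) * x - r x * 1) / x ^ 2 + κ * x⁻¹) =
          ((√m * x - r x) ^ 2 + (f x - m * x) * x) / (r x * x ^ 2) := by
        rw [hκ]
        field_simp
        rw [show m = √m ^ 2 from hsm.symm]
        simp only [Real.sqrt_sq hsm0.le]
        ring
      rw [h2]
      have h3 : 0 ≤ (f x - m * x) * x := mul_nonneg (by linarith) hx0.le
      positivity
  have hlog : Tendsto (fun q => κ * Real.log q) (𝓝[>] 0) atBot :=
    Real.tendsto_log_nhdsGT_zero.const_mul_atBot hκ0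
  obtain ⟨q, hq1, hq2⟩ := ((hlog.eventually_lt_atBot (r a / a + κ * Real.log a - K)).and
    (Ioo_mem_nhdsGT ha.1)).exists
  have h1 := hmono q hq2
  have h2 : r q / q ≤ K := by
    rw [div_le_iff₀ hq2.1]
    have := (hb q).2.1
    rwa [abs_of_pos hq2.1] at this
  linarith

/-- The profile follows the trajectory `L = -p_c` leaving `(0,0)`. The front of speed `s` keeps it
positive on `(0,1)`, `p_c(1) < 0` takes it past `1`, and beyond `1`, where `f = 0`, it has slope
`c`. -/
theorem IsPhaseFront.exists_isUpperProfile (hf : IsReaction f) (hr : IsPhaseFront f s r)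
    (hs : 0 < s) (hc : s < c) : ∃ φ, IsUpperProfile f c φ := by
  have hfc := hf.continuous
  obtain ⟨M, hM0, hM⟩ := hf.exists_lipschitz
  obtain ⟨K, hK, hcK⟩ := exists_slope c hM0
  have hMl : ∀ x, |f x| ≤ M * |x| := fun x => by simpa [hf.map_zero] using hM x 0
  have hc0 : 0 < c := hs.trans hc
  set L : ℝ → ℝ := fun q => -awLimit f c q with hL
  have haw := fun ε (hε : 0 < ε) b (hb : 0 ≤ b) => (hr.awTrajectory_neg hf hs.le hc.le hε hb).1
  have hL1 : 0 < L 1 := neg_pos.2 (hr.awLimit_neg hf hs hc)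
  have hupper : ∀ q ≥ 0, L q ≤ K * q := fun q hq => by
    refine neg_awLimit_le hfc (M := M) (fun x hx => ?_) hM0 hK (by linarith [le_abs_self c]) hq
    have := hMl x
    rw [abs_of_nonneg hx.1] at this
    linarith [neg_abs_le (f x)]
  have hge_r : ∀ q ≥ 0, r q ≤ L q := fun q hq => by
    rw [hL, le_neg]
    refine awLimit_le hfc hq fun ε hε => ?_
    rw [le_neg]
    exact (hr.awTrajectory_neg hf hs.le hc.le hε hq).2
  have hge_1 : ∀ q ≥ 1, L 1 + c * (q - 1) ≤ L q := fun q hq => by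
    have hq0 : 0 ≤ q := zero_le_one.trans hq
    rw [hL, le_neg]
    refine awLimit_le hfc hq0 fun ε hε => ?_
    have hsol := isPhaseSolution_awTrajectory hfc (haw ε hε q hq0)
    have hsub : Icc 1 q ⊆ Icc 0 q := Icc_subset_Icc_left zero_le_one
    have hmono : MonotoneOn (fun x => -awTrajectory f c ε x - c * x) (Icc 1 q) := by
      apply monotoneOn_Icc_of_hasDerivAt ((hsol.continuousOn.mono hsub).sub
        (continuous_const.mul continuous_id).continuousOn)
      intro x hx
      refine ⟨_, ?_, ((hsol x (hsub (Ioo_subset_Icc_self hx))).2.hasDerivAt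
        (Icc_mem_nhds (zero_lt_one.trans hx.1) hx.2)).sub ((hasDerivAt_id x).const_mul c)⟩
      rw [hf.eq_zero_outside x fun h => hx.1.not_ge h.2]
      simp
    have h1 := hmono (left_mem_Icc.2 hq) (right_mem_Icc.2 hq) hq
    have h2 := awTrajectory_le_awLimit (c := c) hfc hε zero_le_one
    simp only at h1 ⊢
    linarith
  have hpos : ∀ q > 0, 0 < L q := fun q hq => by
    rcases lt_or_ge q 1 with h | h
    · exact (hr.sol q ⟨hq, h⟩).1.trans_le (hge_r q hq.le)
    · have := mul_nonneg hc0.le (sub_nonneg.2 h)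
      linarith [hge_1 q h]
  have hsol : IsPhaseSolution f c L (Ioi 0) := by
    intro q hq
    have hq0 : 0 < q := hq
    have h1 := isPhaseSolution_awLimit hfc (by linarith : 0 ≤ q + 1)
      (fun ε hε => haw ε hε (q + 1) (by linarith)) Ioo_subset_Icc_self
      (fun x hx => neg_pos.1 (hpos x hx.1))
    obtain ⟨h2, h3⟩ := h1 q ⟨hq0, by linarith⟩
    exact ⟨h2, (h3.hasDerivAt (Ioo_mem_nhds hq0 (by linarith))).hasDerivWithinAt⟩
  obtain ⟨a, ha, hfa⟩ : ∃ a ∈ Ioo (0 : ℝ) 1, ∀ x ∈ Ioc 0 a, f x < c ^ 2 / 4 * x := by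
    have h1 := hr.four_mul_deriv_le hf hs
    have h2 : s ^ 2 < c ^ 2 := pow_lt_pow_left₀ hc hs.le two_ne_zero
    obtain ⟨a, ha, h⟩ := exists_Ioo_of_eventually_nhdsGT (hf.tendsto_div.eventually
      (gt_mem_nhds (show derivWithin f (Icc 0 1) 0 < c ^ 2 / 4 by linarith)))
    exact ⟨a, ha, fun x hx => (div_lt_iff₀ hx.1).1 (h x hx)⟩
  -- Since `f ≤ c² / 4 * x` on `[0,a]`, the lines `ε + c / 2 * x` are subsolutions there.
  have hge_0 : ∀ q ∈ Ioc 0 a, c / 2 * q ≤ L q := fun q hq => by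
    rw [hL, le_neg]
    refine awLimit_le hfc hq.1.le fun ε hε => ?_
    have hB : IsPhaseSub f c (fun x => ε + c / 2 * x) (Icc 0 q) := by
      intro x hx
      have hx0 : 0 ≤ c / 2 * x := mul_nonneg (by positivity) hx.1
      have hp : 0 < ε + c / 2 * x := by linarith
      refine ⟨hp, c / 2, ?_, ?_⟩
      · have : f x / (ε + c / 2 * x) ≤ c / 2 := by
          rw [div_le_iff₀ hp]
          have h1 : f x ≤ c ^ 2 / 4 * x := by
            rcases hx.1.eq_or_lt with rfl | h
            · rw [hf.map_zero, mul_zero]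
            · exact (hfa x ⟨h, hx.2.trans hq.2⟩).le
          nlinarith [mul_pos hc0 hε]
        linarith
      · simpa using (((hasDerivAt_id x).const_mul (c / 2)).const_add ε).hasDerivWithinAt
    have h1 := (awTrajectory_of_isPhaseSub (ε := ε) hfc hq.1.le hB (by simp)).2
    linarith
  obtain ⟨δ₀, hδ₀, hδL⟩ := exists_pos_lt_of_continuousOn ha.2.le
    (hsol.continuousOn.mono fun q hq => ha.1.trans_le hq.1)
    (fun q hq => hpos q (ha.1.trans_le hq.1))
  -- The three bounds on `δ` serve `(0,a]`, `[a,1]` and `[1,∞)` respectively.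
  obtain ⟨δ, hδ, hδc, hδ0, hδ1⟩ : ∃ δ > 0, δ ≤ c / 2 ∧ δ ≤ δ₀ ∧ δ ≤ L 1 :=
    ⟨min (c / 2) (min δ₀ (L 1)), by positivity, min_le_left _ _,
      (min_le_right _ _).trans (min_le_left _ _), (min_le_right _ _).trans (min_le_right _ _)⟩
  have hlower : ∀ q > 0, δ * q ≤ L q := fun q hq => by
    rcases le_total q a with h | h
    · exact (mul_le_mul_of_nonneg_right hδc hq.le).trans (hge_0 q ⟨hq, h⟩)
    · rcases le_total q 1 with h1 | h1
      · have := hδL q ⟨h, h1⟩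
        nlinarith
      · have := hge_1 q h1
        nlinarith
  have hone : ∀ q ∈ Ici (1 : ℝ), (0 : ℝ) < q := fun q hq => zero_lt_one.trans_le hq
  obtain ⟨φ, h1, h2, h3, h4, h5, h6, h7⟩ := hsol.exists_profile hfc isOpen_Ioi ordConnected_Ioi
    (mem_Ioi.2 (zero_lt_one' ℝ)) (by
      intro Z hZ t
      constructor
      · obtain ⟨q, hq, ht⟩ := exists_le_antideriv_near_zero hK zero_lt_one (Z := Z) (r := L)
          (fun q hq => hZ q hq.1) (fun q hq => ⟨hpos q hq.1, hupper q hq.1.le⟩) t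
        exact ⟨q, hq.1, ht⟩
      · obtain ⟨q, hq, ht⟩ := exists_antideriv_le_near_top hK zero_lt_one (Z := Z) (r := L)
          (fun q hq => hZ q (hone q hq))
          (fun q hq => ⟨hpos q (hone q hq), hupper q (hone q hq).le⟩) t
        exact ⟨q, hone q hq, ht⟩)
  have htop : Tendsto φ atTop (𝓝 0) := by
    refine tendsto_atTop_isGLB h2.antitone ?_
    rw [h5]
    exact isGLB_Ioi
  refine ⟨φ, h1, h2, fun z => by rw [h6, h7]; ring, h4, htop, ?_, ?_⟩
  · have hδi := inv_pos.2 hδ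
    refine ⟨K + δ⁻¹ + 1, by show 1 < _; linarith, fun z => ?_⟩
    have hz : 0 < φ z := h3 z
    have hm : 0 < K + δ⁻¹ + 1 := by positivity
    refine ⟨by positivity, ?_, ?_⟩
    · rw [h6, neg_neg]
      refine le_trans ?_ (hlower _ hz)
      refine mul_le_mul_of_nonneg_right ?_ hz.le
      exact inv_le_of_inv_le₀ hδ (by linarith)
    · rw [h6, neg_neg]
      refine (hupper _ hz.le).trans ?_
      exact mul_le_mul_of_nonneg_right (by linarith) hz.le
  · obtain ⟨b, hb⟩ := eventually_atTop.1 (htop.eventually (gt_mem_nhds ha.1))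
    refine ⟨max b 1, by positivity, fun z hz => ?_⟩
    have hz0 : 0 < φ z := h3 z
    have hza : φ z ≤ a := (hb z ((le_max_left _ _).trans hz)).le
    -- Here `φ'' = c L(φ) - f(φ) ≥ (c² / 2 - c² / 4) φ`.
    rw [h7]
    have e1 := mul_le_mul_of_nonneg_left (hge_0 _ ⟨hz0, hza⟩) hc0.le
    have e2 := hfa _ ⟨hz0, hza⟩
    nlinarith [mul_pos (pow_pos hc0 2) hz0]

end Upper

/-! ### Lower profiles for subcritical speeds -/

section Lower

variable {f r R T : ℝ → ℝ} {c c₀ s q : ℝ}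

/-- A trajectory from `(1,0)` which does not end at `(0,0)` reaches the axis `q = 0`
transversally. -/
theorem IsPhaseSolution.exists_extension_zero {M K q₂ : ℝ} (hf : Continuous f)
    (hM : ∀ x, |f x| ≤ M * |x|) (hM0 : 0 ≤ M) (hK : 0 < K) (hcK : |c| + M / K ≤ K)
    (hR : IsPhaseSolution f c R (Ioo 0 1)) (hq₂ : q₂ ∈ Ioo (0 : ℝ) 1) (hlt : K * q₂ < R q₂) :
    ∃ R', IsPhaseSolution f c R' (Ico 0 1) ∧ EqOn R' R (Ioo 0 1) := by
  have hg := continuous_reflection hf q₂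
  -- Followed leftwards from `q₂`, the line of slope `K` through `(q₂, R q₂)` is a barrier, still
  -- positive at `q = 0` because `R q₂ > K q₂`.
  have hB : IsPhaseSub (fun x => -f (q₂ - x)) (-c) (fun x => K * (q₂ - x) + (R q₂ - K * q₂))
      (Icc 0 q₂) := by
    intro x hx
    have hx0 : 0 ≤ q₂ - x := sub_nonneg.2 hx.2
    have hpos : 0 < K * (q₂ - x) + (R q₂ - K * q₂) := by
      have := mul_nonneg hK.le hx0
      linarith
    refine ⟨hpos, -K, ?_, ?_⟩
    · have : -f (q₂ - x) / (K * (q₂ - x) + (R q₂ - K * q₂)) ≤ M / K := by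
        rw [div_le_iff₀ hpos]
        have e : M / K * (K * (q₂ - x) + (R q₂ - K * q₂)) =
            M * (q₂ - x) + M / K * (R q₂ - K * q₂) := by field_simp
        have h3 : 0 ≤ M / K * (R q₂ - K * q₂) := mul_nonneg (by positivity) (by linarith)
        have h4 := hM (q₂ - x)
        rw [abs_of_nonneg hx0] at h4
        linarith [neg_abs_le (f (q₂ - x))]
      linarith [le_abs_self c]
    · simpa using ((((hasDerivAt_id x).const_sub q₂).const_mul K).add_const
        (R q₂ - K * q₂)).hasDerivWithinAt
  obtain ⟨S, hS, hS0⟩ := hB.exists_solution (ρ := R q₂) hg hq₂.1.le (by simp)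
  have hpre : ∀ x ∈ Icc 0 q₂, q₂ - x ∈ Icc 0 q₂ := fun x hx =>
    ⟨sub_nonneg.2 hx.2, sub_le_self _ hx.1⟩
  have hS' : IsPhaseSolution f c (fun q => S (q₂ - q)) (Icc 0 q₂) := (hS.of_reflect q₂).mono hpre
  have hSR : ∀ q ∈ Ioc 0 q₂, S (q₂ - q) = R q := by
    intro q hq
    have h1 := (hR.reflect q₂).mono (t := Icc 0 (q₂ - q)) fun x hx => by
      show q₂ - x ∈ Ioo (0 : ℝ) 1
      exact ⟨by linarith [hx.2, hq.1], by linarith [hx.1, hq₂.2]⟩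
    have h2 := (hS.mono (Icc_subset_Icc_right (by linarith [hq.1] : q₂ - q ≤ q₂))).eqOn hg h1
      (by simp [hS0]) (right_mem_Icc.2 (sub_nonneg.2 hq.2))
    simpa using h2
  set R' : ℝ → ℝ := fun q => if q ≤ q₂ then S (q₂ - q) else R q with hR'
  have h1 : EqOn R' (fun q => S (q₂ - q)) (Icc 0 q₂) := fun q hq => if_pos hq.2
  have h2 : EqOn R' R (Ioo 0 1) := fun q hq => by
    by_cases h : q ≤ q₂
    · simp only [hR', if_pos h]; exact hSR q ⟨hq.1, h⟩
    · simp only [hR', if_neg h]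
  refine ⟨R', fun q hq => ?_, h2⟩
  rcases hq.1.eq_or_lt with rfl | h
  · obtain ⟨a1, a2⟩ := (hS'.congr h1) 0 (left_mem_Icc.2 hq₂.1.le)
    refine ⟨a1, a2.mono_of_mem_nhdsWithin ?_⟩
    rw [nhdsWithin_Ico_eq_nhdsGE zero_lt_one]
    exact Icc_mem_nhdsGE hq₂.1
  · obtain ⟨a1, a2⟩ := (hR.congr h2) q ⟨h, hq.2⟩
    exact ⟨a1, (a2.hasDerivAt (Ioo_mem_nhds h hq.2)).hasDerivWithinAt⟩

/-- Below a trajectory from `(1,0)` to a point `(0,-R 0)`, there are trajectories which cross the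
axis `p = 0` at points close to `(1,0)`. -/
theorem IsPhaseSolution.exists_below {K θ : ℝ} (hf : Continuous f) (hc : 0 < c) (hK : 0 < K)
    (hR : IsPhaseSolution f c R (Ico 0 1)) (hle : ∀ q ∈ Ioo (0 : ℝ) 1, R q ≤ K * (1 - q))
    (hθ : θ ∈ Ioo (0 : ℝ) 1) :
    ∃ q₁ ∈ Ioo θ 1, ∃ T, IsPhaseSolution f c T (Ico 0 q₁) ∧ ContinuousOn T (Icc 0 q₁) ∧
      T q₁ = 0 := by
  obtain ⟨m, hm, hmR⟩ := exists_pos_lt_of_continuousOn hθ.1.le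
    (hR.continuousOn.mono fun q hq => ⟨hq.1, hq.2.trans_lt hθ.2⟩)
    (fun q hq => (hR q ⟨hq.1, hq.2.trans_lt hθ.2⟩).1)
  obtain ⟨p, hp, hpm⟩ : ∃ p ∈ Ioo θ 1, R p < m := by
    have h1 : max θ (1 - m / K) < 1 := max_lt hθ.2 (by linarith [div_pos hm hK])
    obtain ⟨p, hp1, hp2⟩ := exists_between h1
    have hpθ := (le_max_left _ _).trans_lt hp1
    refine ⟨p, ⟨hpθ, hp2⟩, (hle p ⟨hθ.1.trans hpθ, hp2⟩).trans_lt ?_⟩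
    have h2 : 1 - p < m / K := by linarith [(le_max_right θ (1 - m / K)).trans_lt hp1]
    rwa [lt_div_iff₀' hK] at h2
  have hp0 : 0 < p := hθ.1.trans hp.1
  have hcont : ContinuousOn R (Icc 0 p) := hR.continuousOn.mono fun q hq => ⟨hq.1, hq.2.trans_lt hp.2⟩
  -- Let `q₁` be the first point of `[0,p]` where `R ≤ R p`. Then `R > R q₁` to its left, and `R p <
  -- m` forces `q₁ > θ`.
  have hclosed : IsCompact (Icc 0 p ∩ R ⁻¹' Iic (R p)) :=
    isCompact_Icc.of_isClosed_subset (hcont.preimage_isClosed_of_isClosed isClosed_Icc isClosed_Iic)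
      inter_subset_left
  obtain ⟨q₁, ⟨hq₁, hRq₁⟩, hmin⟩ := hclosed.exists_isLeast
    ⟨p, right_mem_Icc.2 hp0.le, (show R p ≤ R p from le_rfl)⟩
  have hRq₁' : R q₁ ≤ R p := hRq₁
  have hq₁θ : θ < q₁ := by
    by_contra! h
    linarith [hmR q₁ ⟨hq₁.1, h⟩]
  have hq₁0 : 0 < q₁ := hθ.1.trans hq₁θ
  have hq₁1 : q₁ < 1 := hq₁.2.trans_lt hp.2
  have hgt : ∀ q ∈ Ico 0 q₁, R q₁ < R q := fun q hq => by
    by_contra! h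
    exact hq.2.not_ge (hmin ⟨⟨hq.1, hq.2.le.trans hq₁.2⟩, h.trans hRq₁'⟩)
  have hv : 0 < R q₁ := (hR q₁ ⟨hq₁.1, hq₁1⟩).1
  have hg := continuous_reflection hf q₁
  have hRr : IsPhaseSolution (fun x => -f (q₁ - x)) (-c) (fun x => R (q₁ - x)) (Icc 0 q₁) :=
    (hR.reflect q₁).mono fun x hx => by
      show q₁ - x ∈ Ico (0 : ℝ) 1
      exact ⟨sub_nonneg.2 hx.2, by linarith [hx.1]⟩
  have hge : ∀ x ∈ Icc 0 q₁, R q₁ ≤ R (q₁ - x) := fun x hx => by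
    rcases hx.1.eq_or_lt with rfl | h
    · rw [sub_zero]
    · exact (hgt _ ⟨sub_nonneg.2 hx.2, by linarith⟩).le
  have haw' : ∀ ε > 0, ε ≤ R q₁ → ∀ x ∈ Icc 0 q₁,
      awTrajectory (fun x => -f (q₁ - x)) (-c) ε x < 0 ∧
      √(R (q₁ - x) ^ 2 - R q₁ ^ 2) ≤ -awTrajectory (fun x => -f (q₁ - x)) (-c) ε x := by
    intro ε hε hεv x hx
    have hsub : Icc 0 x ⊆ Icc 0 q₁ := Icc_subset_Icc_right hx.2
    have hsqle : ∀ y ∈ Icc 0 q₁, R q₁ ^ 2 ≤ R (q₁ - y) ^ 2 := fun y hy =>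
      pow_le_pow_left₀ hv.le (hge y hy) 2
    -- Lowering `R²` by the constant `R(q₁)² - ε² ≥ 0` gives a subsolution of the reflected
    -- equation, since its root is at most `R` and the speed is `-c < 0`. It starts from `ε`, and as
    -- `ε → 0` it stays positive off `x = 0` by the choice of `q₁`.
    have hB : IsPhaseSub (fun x => -f (q₁ - x)) (-c)
        (fun x => √(R (q₁ - x) ^ 2 - R q₁ ^ 2 + ε ^ 2)) (Icc 0 x) := by
      refine isPhaseSub_sqrt (fun y hy => ?_) (fun y hy =>
        ((hRr.mono hsub).hasDerivWithinAt_sq hy).sub_const _ |>.add_const _) fun y hy => ?_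
      · have := hsqle y (hsub hy)
        have := pow_pos hε 2
        linarith
      · have h1 : √(R (q₁ - y) ^ 2 - R q₁ ^ 2 + ε ^ 2) ≤ R (q₁ - y) := by
          rw [Real.sqrt_le_left (hRr y (hsub hy)).1.le]
          have := pow_le_pow_left₀ hε.le hεv 2
          linarith
        have := mul_le_mul_of_nonneg_left h1 hc.le
        linarith
    obtain ⟨h1, h2⟩ := awTrajectory_of_isPhaseSub (ε := ε) hg hx.1 hB
      (by simp [Real.sqrt_sq hε.le])
    refine ⟨h1, le_trans (Real.sqrt_le_sqrt ?_) h2⟩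
    linarith [sq_nonneg ε]
  -- Monotonicity in `ε` removes the restriction `ε ≤ R q₁`.
  have haw : ∀ ε > 0, ∀ x ∈ Icc 0 q₁, awTrajectory (fun x => -f (q₁ - x)) (-c) ε x < 0 ∧
      √(R (q₁ - x) ^ 2 - R q₁ ^ 2) ≤ -awTrajectory (fun x => -f (q₁ - x)) (-c) ε x := by
    intro ε hε x hx
    obtain ⟨h1, h2⟩ := haw' (min ε (R q₁)) (lt_min hε hv) (min_le_right _ _) x hx
    have h3 := awTrajectory_anti (c := -c) hg le_rfl (min_le_left ε (R q₁)) hx.1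
    exact ⟨h3.trans_lt h1, by linarith⟩
  set L : ℝ → ℝ := fun x => -awLimit (fun x => -f (q₁ - x)) (-c) x with hL
  have hL0 : ∀ x ∈ Ioc 0 q₁, 0 < L x := by
    intro x hx
    have h1 : √(R (q₁ - x) ^ 2 - R q₁ ^ 2) ≤ L x := by
      rw [hL, le_neg]
      refine awLimit_le hg hx.1.le fun ε hε => ?_
      rw [le_neg]
      exact (haw ε hε x (Ioc_subset_Icc_self hx)).2
    refine lt_of_lt_of_le (Real.sqrt_pos.2 (sub_pos.2 ?_)) h1
    exact pow_lt_pow_left₀ (hgt _ ⟨sub_nonneg.2 hx.2, by linarith [hx.1]⟩) hv.le two_ne_zero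
  have hsol : IsPhaseSolution (fun x => -f (q₁ - x)) (-c) L (Ioc 0 q₁) :=
    isPhaseSolution_awLimit hg hq₁0.le (fun ε hε => (haw ε hε q₁ (right_mem_Icc.2 hq₁0.le)).1)
      Ioc_subset_Icc_self fun x hx => neg_pos.1 (hL0 x hx)
  have hLc : ContinuousOn L (Icc 0 q₁) := by
    have h1 : ContinuousOn (fun x => √(awLimit (fun x => -f (q₁ - x)) (-c) x ^ 2)) (Icc 0 q₁) :=
      ContinuousOn.sqrt fun x hx => (hasDerivWithinAt_awLimit_sq hg hq₁0.le
        (fun ε hε => (haw ε hε q₁ (right_mem_Icc.2 hq₁0.le)).1) hx).continuousWithinAt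
    refine h1.congr fun x hx => ?_
    change L x = √(awLimit (fun x => -f (q₁ - x)) (-c) x ^ 2)
    rw [← neg_sq, Real.sqrt_sq (neg_nonneg.2 (awLimit_nonpos hg hx.1))]
  refine ⟨q₁, ⟨hq₁θ, hq₁1⟩, fun q => L (q₁ - q), (hsol.of_reflect q₁).mono fun q hq => ?_,
    hLc.comp (continuous_const.sub continuous_id).continuousOn fun q hq => ?_, ?_⟩
  · exact ⟨sub_pos.2 hq.2, sub_le_self _ hq.1⟩
  · exact ⟨sub_nonneg.2 hq.2, sub_le_self _ hq.1⟩
  · simp only [sub_self, hL, awLimit_zero hg, neg_zero]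

theorem hasDerivWithinAt_Icc_of_Ioo {φ g : ℝ → ℝ} {a b : ℝ} (hab : a < b)
    (hφ : ContinuousOn φ (Icc a b)) (hg : ContinuousOn g (Icc a b))
    (h : ∀ z ∈ Ioo a b, HasDerivAt φ (g z) z) :
    ∀ z ∈ Icc a b, HasDerivWithinAt φ (g z) (Icc a b) z := by
  have hd : DifferentiableOn ℝ φ (Ioo a b) := fun z hz =>
    (h z hz).differentiableAt.differentiableWithinAt
  intro z hz
  rcases eq_endpoints_or_mem_Ioo_of_mem_Icc hz with rfl | rfl | hz'
  · refine HasDerivWithinAt.mono (t := Ici z) ?_ Icc_subset_Ici_self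
    refine hasDerivWithinAt_Ici_of_tendsto_deriv hd ((hφ z hz).mono Ioo_subset_Icc_self)
      (Ioo_mem_nhdsGT hab) ?_
    have h1 : Tendsto g (𝓝[>] z) (𝓝 (g z)) := by
      have := (hg z hz).mono Ioo_subset_Icc_self
      rwa [ContinuousWithinAt, nhdsWithin_Ioo_eq_nhdsGT hab] at this
    refine h1.congr' ?_
    filter_upwards [Ioo_mem_nhdsGT hab] with x hx using (h x hx).deriv.symm
  · refine HasDerivWithinAt.mono (t := Iic z) ?_ Icc_subset_Iic_self
    refine hasDerivWithinAt_Iic_of_tendsto_deriv hd ((hφ z hz).mono Ioo_subset_Icc_self)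
      (Ioo_mem_nhdsLT hab) ?_
    have h1 : Tendsto g (𝓝[<] z) (𝓝 (g z)) := by
      have := (hg z hz).mono Ioo_subset_Icc_self
      rwa [ContinuousWithinAt, nhdsWithin_Ioo_eq_nhdsLT hab] at this
    refine h1.congr' ?_
    filter_upwards [Ioo_mem_nhdsLT hab] with x hx using (h x hx).deriv.symm
  · exact (h z hz').hasDerivWithinAt

-- Finite travel time from `(q₁,0)`: `f / T = c - T'` is nonnegative near `q₁` with a continuous
-- primitive, hence integrable, and `f` is bounded below by a positive constant there.
open MeasureTheory in
theorem IsPhaseSolution.integrableOn_inv {θ q₁ : ℝ} (hf : Continuous f) (hθ : 0 < θ) (hθq : θ < q₁)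
    (hfpos : ∀ x ∈ Icc θ q₁, 0 < f x) (hT : IsPhaseSolution f c T (Ico 0 q₁))
    (hTc : ContinuousOn T (Icc 0 q₁)) : IntegrableOn (fun q => (T q)⁻¹) (Ioo 0 q₁) := by
  have hinv : ContinuousOn (fun q => (T q)⁻¹) (Ico 0 q₁) :=
    hT.continuousOn.inv₀ fun q hq => (hT q hq).1.ne'
  obtain ⟨m, hm, hmf⟩ := exists_pos_lt_of_continuousOn hθq.le hf.continuousOn hfpos
  have h1 : IntegrableOn (fun q => f q / T q) (Ioc θ q₁) := by
    refine intervalIntegral.integrableOn_deriv_of_nonneg (g := fun q => c * q - T q) ?_ ?_ ?_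
    · exact (continuous_const.mul continuous_id).continuousOn.sub
        (hTc.mono (Icc_subset_Icc_left hθ.le))
    · intro x hx
      have hx0 := hθ.trans hx.1
      refine (((hasDerivAt_id x).const_mul c).sub ((hT x ⟨hx0.le, hx.2⟩).2.hasDerivAt
        (Ico_mem_nhds hx0 hx.2))).congr_deriv ?_
      ring
    · intro x hx
      exact div_nonneg (hfpos x (Ioo_subset_Icc_self hx)).le (hT x ⟨(hθ.trans hx.1).le, hx.2⟩).1.le
  have h2 : IntegrableOn (fun q => (T q)⁻¹) (Ioo θ q₁) := by
    refine ((h1.mono_set Ioo_subset_Ioc_self).const_mul m⁻¹).mono'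
      ((hinv.mono fun q hq => ⟨(hθ.trans hq.1).le, hq.2⟩).aestronglyMeasurable measurableSet_Ioo) ?_
    refine (ae_restrict_iff' measurableSet_Ioo).2 (Eventually.of_forall fun x hx => ?_)
    have hTx := (hT x ⟨(hθ.trans hx.1).le, hx.2⟩).1
    rw [Real.norm_eq_abs, abs_of_pos (inv_pos.2 hTx), div_eq_mul_inv, ← mul_assoc]
    refine le_mul_of_one_le_left (inv_pos.2 hTx).le ?_
    rw [inv_mul_eq_div, one_le_div hm]
    exact (hmf x (Ioo_subset_Icc_self hx)).le
  have h3 : IntegrableOn (fun q => (T q)⁻¹) (Icc 0 θ) :=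
    (hinv.mono fun q hq => ⟨hq.1, hq.2.trans_lt hθq⟩).integrableOn_Icc
  refine (h3.union h2).mono_set fun q hq => ?_
  rcases le_or_gt q θ with h | h
  · exact Or.inl ⟨hq.1.le, h⟩
  · exact Or.inr ⟨h, hq.2⟩

open MeasureTheory in
/-- A strictly increasing homeomorphism with prescribed positive derivative in an interval. -/
theorem exists_orderIso_of_integrableOn {k : ℝ → ℝ} {b : ℝ} (hb : 0 < b)
    (hk : ContinuousOn k (Ioo 0 b)) (hkpos : ∀ q ∈ Ioo 0 b, 0 < k q)
    (hki : IntegrableOn k (Ioo 0 b)) :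
    ∃ e : ℝ ≃o ℝ, e 0 = 0 ∧ ∀ q ∈ Ioo 0 b, HasDerivAt e (k q) q := by
  classical
  -- The density is continued by `1` outside `(0,b)`, so that its primitive is a bijection of `ℝ`.
  set h : ℝ → ℝ := fun q => 1 + indicator (Ioo 0 b) (fun q => k q - 1) q with hh
  have hin : ∀ q ∈ Ioo 0 b, h q = k q := fun q hq => by simp [hh, indicator_of_mem hq]
  have hout : ∀ q ∉ Ioo 0 b, h q = 1 := fun q hq => by simp [hh, indicator_of_notMem hq]
  have hpos : ∀ q, 0 < h q := fun q => by
    by_cases hq : q ∈ Ioo 0 b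
    · rw [hin q hq]; exact hkpos q hq
    · rw [hout q hq]; exact one_pos
  have hint : ∀ x y, IntervalIntegrable h volume x y := fun x y => by
    refine intervalIntegrable_const.add (Integrable.intervalIntegrable ?_)
    rw [integrable_indicator_iff measurableSet_Ioo]
    exact hki.sub (integrableOn_const (by simp))
  set W : ℝ → ℝ := fun x => ∫ t in (0 : ℝ)..x, h t with hW
  have hsub : ∀ x y, W y - W x = ∫ t in x..y, h t := fun x y =>
    intervalIntegral.integral_interval_sub_left (hint _ _) (hint _ _)
  have hWc : Continuous W := intervalIntegral.continuous_primitive hint 0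
  have hmono : StrictMono W := fun x y hxy => by
    rw [← sub_pos, hsub]
    exact intervalIntegral.intervalIntegral_pos_of_pos (hint _ _) hpos hxy
  have hW0 : W 0 = 0 := intervalIntegral.integral_same
  have hone : ∀ x y, x ≤ y → (∀ q ∈ Icc x y, q ∉ Ioo 0 b) → W y - W x = y - x := by
    intro x y hxy hq
    rw [hsub, intervalIntegral.integral_congr (g := fun _ => (1 : ℝ))]
    · simp
    · intro q hq'
      rw [uIcc_of_le hxy] at hq'
      exact hout q (hq q hq')
  have hsurj : Function.Surjective W := by
    intro y
    refine mem_range_of_exists_le_of_exists_ge hWc ⟨min y 0, ?_⟩ ⟨b + |y|, ?_⟩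
    · have := hone (min y 0) 0 (min_le_right _ _) fun q hq hq' => hq.2.not_gt hq'.1
      linarith [min_le_left y 0]
    · have h1 := hone b (b + |y|) (by linarith [abs_nonneg y]) fun q hq hq' => hq.1.not_gt hq'.2
      linarith [hmono hb, le_abs_self y]
  refine ⟨hmono.orderIsoOfSurjective W hsurj, hW0, fun q hq => ?_⟩
  have hhc : ContinuousOn h (Ioo 0 b) := hk.congr hin
  have := intervalIntegral.integral_hasDerivAt_right (hint 0 q)
    (hhc.stronglyMeasurableAtFilter isOpen_Ioo q hq) (hhc.continuousAt (isOpen_Ioo.mem_nhds hq))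
  rw [hin q hq] at this
  exact this

/-- The length `a` is the total travel time `∫ 1 / T` over `(0,q₁)`. The equation holds in the open
interval and extends to the end points by continuity of the right-hand sides. -/
theorem IsPhaseSolution.exists_isLowerProfile {θ q₁ : ℝ} (hf : Continuous f) (hθ : 0 < θ)
    (hq₁ : q₁ ∈ Ioo θ 1) (hfpos : ∀ x ∈ Ico θ 1, 0 < f x) (hT : IsPhaseSolution f c T (Ico 0 q₁))
    (hTc : ContinuousOn T (Icc 0 q₁)) (hT0 : T q₁ = 0) :
    ∃ a > 0, ∃ φ, IsLowerProfile f θ c a φ := by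
  have hq0 : 0 < q₁ := hθ.trans hq₁.1
  have hTI : ∀ q ∈ Ioo 0 q₁, 0 < T q := fun q hq => (hT q (Ioo_subset_Ico_self hq)).1
  obtain ⟨e, he0, hed⟩ := exists_orderIso_of_integrableOn hq0
    ((hT.continuousOn.mono Ioo_subset_Ico_self).inv₀ fun q hq => (hTI q hq).ne')
    (fun q hq => inv_pos.2 (hTI q hq))
    (hT.integrableOn_inv hf hθ hq₁.1 (fun x hx => hfpos x ⟨hx.1, hx.2.trans_lt hq₁.2⟩) hTc)
  set a := e q₁ with ha
  have ha0 : 0 < a := by rw [← he0]; exact e.strictMono hq0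
  set φ : ℝ → ℝ := fun z => e.symm (a - z) with hφ
  have hφc : Continuous φ := e.symm.continuous.comp (continuous_const.sub continuous_id)
  have hφ0 : φ 0 = q₁ := by simp [hφ, ha]
  have hφa : φ a = 0 := by simp only [hφ, sub_self]; exact (OrderIso.symm_apply_eq e).2 he0.symm
  have hφanti : StrictAnti φ := fun x y hxy => e.symm.strictMono (sub_lt_sub_left hxy a)
  have hmem : ∀ z ∈ Icc 0 a, φ z ∈ Icc 0 q₁ := fun z hz =>
    ⟨hφa ▸ hφanti.antitone hz.2, hφ0 ▸ hφanti.antitone hz.1⟩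
  have hmem' : ∀ z ∈ Ioo 0 a, φ z ∈ Ioo 0 q₁ := fun z hz =>
    ⟨hφa ▸ hφanti hz.2, hφ0 ▸ hφanti hz.1⟩
  have hTφ : ContinuousOn (fun z => T (φ z)) (Icc 0 a) := hTc.comp hφc.continuousOn hmem
  have hd1 : ∀ z ∈ Ioo 0 a, HasDerivAt φ (-T (φ z)) z := by
    intro z hz
    have hz' := hmem' z hz
    have h1 : HasDerivAt e.symm ((T (φ z))⁻¹)⁻¹ (a - z) :=
      HasDerivAt.of_local_left_inverse e.symm.continuous.continuousAt (hed _ hz')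
        (inv_ne_zero (hTI _ hz').ne') (Eventually.of_forall fun y => e.apply_symm_apply y)
    refine (h1.comp z ((hasDerivAt_id z).const_sub a)).congr_deriv ?_
    rw [inv_inv]; ring
  have hd2 : ∀ z ∈ Ioo 0 a, HasDerivAt (fun z => -T (φ z)) (c * T (φ z) - f (φ z)) z := by
    intro z hz
    have hz' := hmem' z hz
    have h3 := (hT _ (Ioo_subset_Ico_self hz')).2.hasDerivAt (Ico_mem_nhds hz'.1 hz'.2)
    refine (h3.comp z (hd1 z hz)).neg.congr_deriv ?_
    have := (hTI _ hz').ne'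
    field_simp
  have hc2 : ContinuousOn (fun z => c * T (φ z) - f (φ z)) (Icc 0 a) :=
    (continuousOn_const.mul hTφ).sub (hf.comp hφc).continuousOn
  have hD1 := hasDerivWithinAt_Icc_of_Ioo ha0 hφc.continuousOn hTφ.neg hd1
  have hD2 := hasDerivWithinAt_Icc_of_Ioo ha0 hTφ.neg hc2 hd2
  have hu : UniqueDiffOn ℝ (Icc 0 a) := uniqueDiffOn_Icc ha0
  have e1 : ∀ z ∈ Icc 0 a, derivWithin φ (Icc 0 a) z = -T (φ z) := fun z hz =>
    (hD1 z hz).derivWithin (hu z hz)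
  refine ⟨a, ha0, φ, contDiffOn_two_of_hasDerivWithinAt hu hD1 hD2 hc2,
    hφanti.strictAntiOn _, fun z hz => ?_, hφ0 ▸ hq₁, ?_, hφa⟩
  · have e2 : derivWithin (derivWithin φ (Icc 0 a)) (Icc 0 a) z = c * T (φ z) - f (φ z) :=
      ((hD2 z hz).congr e1 (e1 z hz)).derivWithin (hu z hz)
    rw [e2, e1 z hz]; ring
  · rw [e1 0 (left_mem_Icc.2 ha0.le), hφ0, hT0, neg_zero]

/-- The trajectory from `(1,0)` would be a front of speed `c` if it were below the line `K q`; as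
there is none, it exceeds this line somewhere and reaches `q = 0` off the origin. -/
theorem IsPhaseFront.exists_isLowerProfile {θ : ℝ} (hf : IsReaction f) (hr : IsPhaseFront f s r)
    (hc : 0 < c) (hcs : c ≤ s) (hno : ∀ r', ¬ IsPhaseFront f c r') (hθ : θ ∈ Ioo (0 : ℝ) 1)
    (hfpos : ∀ x ∈ Ico θ 1, 0 < f x) : ∃ a > 0, ∃ φ, IsLowerProfile f θ c a φ := by
  obtain ⟨M, hM0, hM⟩ := hf.exists_lipschitz
  obtain ⟨K, hK, hcK⟩ := exists_slope c hM0
  have hMl : ∀ x, |f x| ≤ M * |x| := fun x => by simpa [hf.map_zero] using hM x 0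
  have hMr : ∀ x, |f x| ≤ M * |1 - x| := fun x => by
    have := hM x 1
    rwa [hf.map_one, sub_zero, abs_sub_comm] at this
  have hsol := hr.isPhaseSolution_unstableTrajectory hf hc hcs
  have hright : ∀ q ∈ Ioo (0 : ℝ) 1, unstableTrajectory f c q ≤ K * (1 - q) := fun q hq =>
    unstableTrajectory_le hf.continuous hMr hM0 hK hcK hq.2.le
  obtain ⟨q₂, hq₂, hlt⟩ : ∃ q₂ ∈ Ioo (0 : ℝ) 1, K * q₂ < unstableTrajectory f c q₂ := by
    by_contra! h
    exact hno _ (hsol.isPhaseFront hK h hright)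
  obtain ⟨R, hR, hReq⟩ := hsol.exists_extension_zero hf.continuous hMl hM0 hK hcK hq₂ hlt
  obtain ⟨q₁, hq₁, T, hT, hTc, hT0⟩ := hR.exists_below hf.continuous hc hK
    (fun q hq => (hReq hq).trans_le (hright q hq)) hθ
  exact hT.exists_isLowerProfile hf.continuous hθ.1 hq₁ hfpos hTc hT0

end Lower

/-! ### The minimal speed and its characterizations -/

theorem proposition3p5 (f : ℝ → ℝ) (hf : IsReaction f)
    (hfront : ∃ c₀ > 0, ∃ φ₀ : ℝ → ℝ, IsFrontProfile f c₀ φ₀) :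
    (∃ θ ∈ Ioo (0 : ℝ) 1, ∀ s ∈ Ico θ 1, 0 < f s) ∧
    ∃ cstar : ℝ, 0 < cstar ∧ IsLeast (frontSpeeds f) cstar ∧
      (∀ θ ∈ Ioo (0 : ℝ) 1, (∀ s ∈ Ico θ 1, 0 < f s) →
        ∃ η ∈ Ioo 0 cstar, ∀ c ∈ Ico (cstar - η) cstar,
          ∃ a > 0, ∃ φ : ℝ → ℝ, IsLowerProfile f θ c a φ) ∧
      (∀ c > cstar, ∃ φ : ℝ → ℝ, IsUpperProfile f c φ) ∧
      IsAronsonWeinbergerSpeed f cstar := by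
  obtain ⟨c₀, hc₀, φ₀, hφ₀⟩ := hfront
  obtain ⟨r₀, hr₀⟩ := hφ₀.exists_isPhaseFront hf hc₀
  have hint := hr₀.integral_pos hf hc₀
  obtain ⟨s, hs, ⟨r, hr⟩, hglb⟩ := hr₀.exists_critical hf hc₀
  have hlow : s ∈ lowerBounds (frontSpeeds f) := by
    rintro c ⟨φ, hφ⟩
    have hc := hφ.speed_pos hf.continuous hint
    obtain ⟨r', hr'⟩ := hφ.exists_isPhaseFront hf hc
    -- A front of speed `c` puts every `c' > c` in the set whose infimum is `s`, so `s ≤ c`.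
    exact le_of_forall_gt_imp_ge_of_dense fun c' hc' => hglb.1 (hr'.awLimit_neg hf hc hc')
  refine ⟨hr₀.exists_pos_near_one hf hc₀, s, hs,
    ⟨hr.exists_isFrontProfile hf.continuous, hlow⟩, fun θ hθ hfθ => ?_,
    fun c hc => hr.exists_isUpperProfile hf hs hc,
    fun c q hq => tendsto_awTrajectory hf.continuous hq.1, hglb⟩
  -- Every speed in `(0,s)` has a lower profile; `η = s / 2` only serves to keep `c` positive.
  refine ⟨s / 2, ⟨half_pos hs, half_lt_self hs⟩, fun c hc => ?_⟩
  have hc0 : 0 < c := by linarith [hc.1]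
  exact hr.exists_isLowerProfile hf hc0 hc.2.le (fun r' hr' =>
    hc.2.not_ge (hlow (hr'.exists_isFrontProfile hf.continuous))) hθ hfθ
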